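/- **Theorem.** Let $m,p\geq 1$ be integers and let $(\mathcal H_i)_{1\leq i\leq m}$ and $(\mathcal G_k)_{1\leq k\leq p}$ be real Hilbert spaces. For a real Hilbert space $\mathcal H$, let $\Gamma_0(\mathcal H)$ be the class of proper lower semicontinuous convex functions from $\mathcal H$ to $\left]-\infty,+\infty\right]$ and, for $f\in\Gamma_0(\mathcal H)$ and $x\in\mathcal H$, let $\operatorname{prox}_f x$ be the unique minimizer of $y\mapsto f(y)+\|x-y\|^2/2$. For every $i\in\{1,\ldots,m\}$ let $f_i\in\Gamma_0(\mathcal H_i)$ and, for every $k\in\{1,\ldots,p\}$, let $\tau_k\in\left]0,+\infty\right[$, let $\varphi_k\colon\mathcal G_k\to\mathbb R$ be convex and differentiable with $\tau_k$-Lipschitz continuous gradient, and let $L_{ki}\colon\mathcal H_i\to\mathcal G_k$ be linear and bounded. Assume that $\min_{1\leq k\leq p}\sum_{i=1}^m\|L_{ki}\|^2>0$ and that the problem $$\underset{x_1\in\mathcal H_1,\ldots,x_m\in\mathcal H_m}{\text{minimize}}\;\;\sum_{i=1}^m f_i(x_i)+\sum_{k=1}^p\varphi_k\Big(\sum_{i=1}^m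 L_{ki}x_i\Big)\tag{P}$$ has at least one solution. Set $$\beta=\frac{1}{p\,\max_{1\leq k\leq p}\tau_k\sum_{i=1}^m\|L_{ki}\|^2}.$$ Let $\varepsilon\in\left]0,\min\{1,\beta\}\right[$, let $(\gamma_n)_{n\in\mathbb N}$ be a sequence in $[\varepsilon,2\beta-\varepsilon]$, let $(\lambda_n)_{n\in\mathbb N}$ be a sequence in $[0,1-\varepsilon]$, and let $(x_{1,0},\ldots,x_{m,0})\in\mathcal H_1\times\cdots\times\mathcal H_m$ be arbitrary. For every $i\in\{1,\ldots,m\}$, let 1. $(f_{i,n})_{n\in\mathbb N}$ be functions in $\Gamma_0(\mathcal H_i)$ such that, for every $\rho\in\left]0,+\infty\right[$, $\sum_{n\in\mathbb N}\sup_{\|y\|\leq\rho}\|\operatorname{prox}_{\gamma_n f_{i,n}}y-\operatorname{prox}_{\gamma_n f_i}y\|<+\infty$; 2. $(a_{i,n})_{n\in\mathbb N}$ and $(b_{i,n})_{n\in\mathbb N}$ be sequences in $\mathcal H_i$ such that $\sum_{n\in\mathbb N}\|a_{i,n}\|<+\infty$ and $\sum_{n\in\mathbb N}\|b_{i,n}\|<+\infty$;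 3. $(\lambda_{i,n})_{n\in\mathbb N}$ be a sequence in $\left[0,1\right[$ such that $\sum_{n\in\mathbb N}|\lambda_{i,n}-\lambda_n|<+\infty$. Let the sequences $(x_{i,n})_{n\in\mathbb N}$ be generated, for every $n\in\mathbb N$ and $i\in\{1,\ldots,m\}$, by $$x_{i,n+1}=\lambda_{i,n}x_{i,n}+(1-\lambda_{i,n})\bigg(\operatorname{prox}_{\gamma_n f_{i,n}}\bigg(x_{i,n}-\gamma_n\bigg(\sum_{k=1}^p L_{ki}^*\nabla\varphi_k\Big(\sum_{j=1}^m L_{kj}x_{j,n}\Big)+b_{i,n}\bigg)\bigg)+a_{i,n}\bigg).$$ Then, for every $i\in\{1,\ldots,m\}$, $(x_{i,n})_{n\in\mathbb N}$ converges weakly to a point $x_i\in\mathcal H_i$, and $(x_1,\ldots,x_m)$ is a solution to (P). -/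

import Mathlib

open Filter Topology

noncomputable section

/-- The class `Γ₀(H)`: lower semicontinuous convex functions `f : H → ]-∞, +∞]` that are proper,
i.e. with `dom f = {x | f x < +∞}` nonempty. -/
structure GammaZero {H : Type*} [NormedAddCommGroup H] [InnerProductSpace ℝ H]
    (f : H → EReal) : Prop where
  ne_bot : ∀ x, f x ≠ ⊥
  proper : ∃ x, f x < ⊤
  lsc : LowerSemicontinuous f
  convex : ∀ x y : H, ∀ a b : ℝ, 0 < a → 0 < b → a + b = 1 →
    f (a • x + b • y) ≤ (a : EReal) * f x + (b : EReal) * f y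

/-- `q` minimizes `y ↦ f y + ‖x - y‖² / 2` over `H`. -/
def IsProx {H : Type*} [NormedAddCommGroup H] [InnerProductSpace ℝ H]
    (f : H → EReal) (x q : H) : Prop :=
  IsMinOn (fun y => f y + ((‖x - y‖ ^ 2 / 2 : ℝ) : EReal)) Set.univ q

/-- The proximity operator: `prox f x` is the minimizer of `y ↦ f y + ‖x - y‖² / 2`, which exists
and is unique whenever `f ∈ Γ₀(H)` and `H` is a Hilbert space. -/
def prox {H : Type*} [NormedAddCommGroup H] [InnerProductSpace ℝ H]
    (f : H → EReal) (x : H) : H :=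
  Classical.epsilon (IsProx f x)

/-- `φ` is differentiable and its gradient is Lipschitz continuous with constant `τ`. -/
def LipschitzDifferentiable {G : Type*} [NormedAddCommGroup G] [InnerProductSpace ℝ G]
    [CompleteSpace G] (τ : ℝ) (φ : G → ℝ) : Prop :=
  Differentiable ℝ φ ∧ ∀ x y : G, ‖gradient φ x - gradient φ y‖ ≤ τ * ‖x - y‖

/-- The objective `(x₁, …, xₘ) ↦ ∑ᵢ fᵢ(xᵢ) + ∑ₖ φₖ(∑ᵢ Lₖᵢ xᵢ)`, with values in `]-∞, +∞]`. -/
def objective {m p : ℕ} {H : Fin m → Type*} {G : Fin p → Type*}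
    [∀ i, NormedAddCommGroup (H i)] [∀ i, InnerProductSpace ℝ (H i)]
    [∀ k, NormedAddCommGroup (G k)] [∀ k, InnerProductSpace ℝ (G k)]
    (f : ∀ i, H i → EReal) (φ : ∀ k, G k → ℝ) (L : ∀ k i, H i →L[ℝ] G k)
    (x : ∀ i, H i) : EReal :=
  ∑ i, f i (x i) + ((∑ k, φ k (∑ i, L k i (x i)) : ℝ) : EReal)

/-- The coupling operator `Bᵢ : (x₁, …, xₘ) ↦ ∑ₖ Lₖᵢ* ∇φₖ(∑ⱼ Lₖⱼ xⱼ)`. -/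
def couplingOp {m p : ℕ} {H : Fin m → Type*} {G : Fin p → Type*}
    [∀ i, NormedAddCommGroup (H i)] [∀ i, InnerProductSpace ℝ (H i)] [∀ i, CompleteSpace (H i)]
    [∀ k, NormedAddCommGroup (G k)] [∀ k, InnerProductSpace ℝ (G k)] [∀ k, CompleteSpace (G k)]
    (φ : ∀ k, G k → ℝ) (L : ∀ k i, H i →L[ℝ] G k) (i : Fin m) (x : ∀ j, H j) : H i :=
  ∑ k, ContinuousLinearMap.adjoint (L k i) (gradient (φ k) (∑ j, L k j (x j)))

/-- The constant `β = 1 / (p · maxₖ τₖ ∑ᵢ ‖Lₖᵢ‖²)`; the supremum is over a finite set, so it is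
the maximum as soon as `p ≥ 1`. -/
def betaConst {m p : ℕ} {H : Fin m → Type*} {G : Fin p → Type*}
    [∀ i, NormedAddCommGroup (H i)] [∀ i, InnerProductSpace ℝ (H i)]
    [∀ k, NormedAddCommGroup (G k)] [∀ k, InnerProductSpace ℝ (G k)]
    (τ : Fin p → ℝ) (L : ∀ k i, H i →L[ℝ] G k) : ℝ :=
  1 / ((p : ℝ) * ⨆ k, τ k * ∑ i, ‖L k i‖ ^ 2)

end

/-! On the Hilbert product `PiLp 2 H`, the solutions of (P) are the zeros of `A + B`. Here `A` is
the product of the subdifferentials of the `f i`, and `B`, with components `couplingOp φ L i`, is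
the gradient of the smooth part. Coordinatewise proximity operators are the resolvents of `A`, so
the algorithm is a perturbed forward-backward iteration.

Three facts carry the proof. By Baillon-Haddad each `gradient (φ k)` is `1/τ k`-cocoercive, and
Cauchy-Schwarz turns this into β-cocoercivity of `B`, which allows step sizes up to nearly 2β. All
inexactness (approximate functions, `a`, `b`, individual relaxations) amounts to one summable
perturbation of the exact iteration (`summable_norm_forward_backward_error`). The approximation of
the proximity operators is controlled only on balls, so boundedness of the iterates comes first,
from a Gronwall estimate. Finally (`forward_backward_tendsto`), the distance to every zero
converges, and the decrease it measures forces the residual to 0 and `B (x n)` to converge strongly.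
Monotonicity then makes every weak cluster point a zero, and Opial's lemma concludes. Cluster points
are limits along ultrafilters, so no subsequence is extracted. -/

open scoped RealInnerProductSpace

/-! ### Weak convergence of the forward-backward iteration with summable errors -/

section ForwardBackward

/-- A nonnegative real sequence which increases by at most a summable amount converges. -/
theorem exists_tendsto_of_le_add_summable {r e : ℕ → ℝ} (hr : ∀ n, 0 ≤ r n) (he0 : ∀ n, 0 ≤ e n)
    (he : Summable e) (h : ∀ n, r (n + 1) ≤ r n + e n) : ∃ d, Tendsto r atTop (𝓝 d) := by
  have hanti : Antitone fun n => r n - ∑ k ∈ Finset.range n, e k := by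
    refine antitone_nat_of_succ_le fun n => ?_
    rw [Finset.sum_range_succ]
    linarith [h n]
  have hbdd : BddBelow (Set.range fun n => r n - ∑ k ∈ Finset.range n, e k) := by
    refine ⟨-∑' k, e k, ?_⟩
    rintro _ ⟨n, rfl⟩
    have := he.sum_le_tsum (Finset.range n) fun k _ => he0 k
    have := hr n
    dsimp only
    linarith
  have h1 := tendsto_atTop_ciInf hanti hbdd
  have h2 := h1.add he.hasSum.tendsto_sum_nat
  exact ⟨_, by simpa using h2⟩

/-- Discrete Gronwall inequality with summable coefficients. -/
theorem exists_bound_of_le_mul_add_summable {r α e : ℕ → ℝ} (hr : ∀ n, 0 ≤ r n)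
    (hα0 : ∀ n, 0 ≤ α n) (he0 : ∀ n, 0 ≤ e n) (hα : Summable α) (he : Summable e)
    (h : ∀ n, r (n + 1) ≤ (1 + α n) * r n + e n) : ∃ C, ∀ n, r n ≤ C := by
  have key : ∀ n, r n ≤ Real.exp (∑ k ∈ Finset.range n, α k) *
      (r 0 + ∑ k ∈ Finset.range n, e k) := by
    intro n
    induction n with
    | zero => simp
    | succ n ih =>
      rw [Finset.sum_range_succ, Finset.sum_range_succ, Real.exp_add]
      set S := ∑ k ∈ Finset.range n, α k
      set T := r 0 + ∑ k ∈ Finset.range n, e k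
      have hS : 1 ≤ Real.exp S := Real.one_le_exp (Finset.sum_nonneg fun k _ => hα0 k)
      have hT : 0 ≤ T := add_nonneg (hr 0) (Finset.sum_nonneg fun k _ => he0 k)
      have h1 : 1 + α n ≤ Real.exp (α n) := by linarith [Real.add_one_le_exp (α n)]
      have h2 : 1 ≤ Real.exp (α n) := Real.one_le_exp (hα0 n)
      calc r (n + 1) ≤ (1 + α n) * r n + e n := h n
        _ ≤ Real.exp (α n) * (Real.exp S * T) + (Real.exp S * Real.exp (α n)) * e n := by
          gcongr
          · exact hr n
          · exact le_mul_of_one_le_left (he0 n) (one_le_mul_of_one_le_of_one_le hS h2)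
        _ = Real.exp S * Real.exp (α n) * (r 0 + (∑ k ∈ Finset.range n, e k + e n)) := by
          simp only [T]; ring
  refine ⟨Real.exp (∑' k, α k) * (r 0 + ∑' k, e k), fun n => (key n).trans ?_⟩
  have h1 := hα.sum_le_tsum (Finset.range n) fun k _ => hα0 k
  have h2 := he.sum_le_tsum (Finset.range n) fun k _ => he0 k
  have h3 : 0 ≤ ∑ k ∈ Finset.range n, e k := Finset.sum_nonneg fun k _ => he0 k
  have := hr 0
  gcongr

variable {E : Type*} [NormedAddCommGroup E] [InnerProductSpace ℝ E]

/-- A bounded sequence in a Hilbert space has a weak limit along every ultrafilter. -/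
theorem exists_tendsto_inner_ultrafilter [CompleteSpace E] {x : ℕ → E} {C : ℝ}
    (hx : ∀ n, ‖x n‖ ≤ C)
    (l : Ultrafilter ℕ) : ∃ z : E, ∀ y, Tendsto (fun n => ⟪x n, y⟫) l (𝓝 ⟪z, y⟫) := by
  have h1 : ∀ y, ∀ n, |⟪x n, y⟫| ≤ C * ‖y‖ := fun y n =>
    (abs_real_inner_le_norm _ _).trans (by gcongr; exact hx n)
  have h2 : ∀ y, ∃ t, Tendsto (fun n => ⟪x n, y⟫) l (𝓝 t) := by
    intro y
    obtain ⟨t, -, ht⟩ := (isCompact_Icc (a := -(C * ‖y‖)) (b := C * ‖y‖)).ultrafilter_le_nhds'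
      (l.map fun n => ⟪x n, y⟫)
      (Ultrafilter.mem_map.2 <| univ_mem' fun n => abs_le.1 (h1 y n))
    exact ⟨t, ht⟩
  choose g hg using h2
  -- The pointwise limits form a linear functional bounded by `C`; its Riesz representative is the
  -- weak limit.
  let φ : E →ₗ[ℝ] ℝ :=
    { toFun := g
      map_add' := fun u v => tendsto_nhds_unique (hg (u + v))
        (by simpa [inner_add_right] using (hg u).add (hg v))
      map_smul' := fun c u => tendsto_nhds_unique (hg (c • u))
        (by simpa [inner_smul_right] using (hg u).const_mul c) }
  let ψ : E →L[ℝ] ℝ := φ.mkContinuous C fun y =>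
    le_of_tendsto (hg y).abs (Eventually.of_forall (h1 y))
  refine ⟨(InnerProductSpace.toDual ℝ E).symm ψ, fun y => ?_⟩
  rw [InnerProductSpace.toDual_symm_apply]
  exact hg y

/-- Opial's lemma: if `‖x n - s‖` converges for every `s` in a nonempty set `S` containing all
weak limits of `x` along ultrafilters, then `x` converges weakly to a point of `S`. -/
theorem opial [CompleteSpace E] {x : ℕ → E} {S : Set E} (hS : S.Nonempty)
    (hconv : ∀ s ∈ S, ∃ d, Tendsto (fun n => ‖x n - s‖) atTop (𝓝 d))
    (hcl : ∀ (l : Ultrafilter ℕ) (z : E), (l : Filter ℕ) ≤ atTop →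
      (∀ y, Tendsto (fun n => ⟪x n, y⟫) l (𝓝 ⟪z, y⟫)) → z ∈ S) :
    ∃ z ∈ S, ∀ y, Tendsto (fun n => ⟪x n, y⟫) atTop (𝓝 ⟪z, y⟫) := by
  obtain ⟨s, hs⟩ := hS
  obtain ⟨C, hC⟩ : ∃ C, ∀ n, ‖x n‖ ≤ C := by
    obtain ⟨d, hd⟩ := hconv s hs
    obtain ⟨C, hC⟩ := hd.bddAbove_range
    refine ⟨C + ‖s‖, fun n => ?_⟩
    have h1 : ‖x n - s‖ ≤ C := hC ⟨n, rfl⟩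
    have h2 : ‖x n‖ ≤ ‖x n - s‖ + ‖s‖ := by simpa using norm_add_le (x n - s) s
    linarith
  obtain ⟨z, hz⟩ := exists_tendsto_inner_ultrafilter hC (Ultrafilter.of atTop)
  have hzS := hcl _ z (Ultrafilter.of_le atTop) hz
  refine ⟨z, hzS, fun y => (tendsto_iff_ultrafilter _ _ _).2 fun l hl => ?_⟩
  obtain ⟨w, hw⟩ := exists_tendsto_inner_ultrafilter hC l
  have hwS := hcl _ w hl hw
  obtain ⟨d₁, hd₁⟩ := hconv z hzS
  obtain ⟨d₂, hd₂⟩ := hconv w hwS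
  -- Polarization: this inner product depends only on the two convergent distances, so it has a
  -- limit along the whole sequence. Hence both cluster points pair equally with `w - z`.
  have hlim : Tendsto (fun n => ⟪x n, w - z⟫) atTop
      (𝓝 ((d₁ ^ 2 - d₂ ^ 2 - ‖z‖ ^ 2 + ‖w‖ ^ 2) / 2)) := by
    have := ((((hd₁.pow 2).sub (hd₂.pow 2)).sub_const (‖z‖ ^ 2)).add_const (‖w‖ ^ 2)).div_const 2
    refine this.congr fun n => ?_
    rw [norm_sub_sq_real, norm_sub_sq_real, inner_sub_right]
    ring
  have e1 := tendsto_nhds_unique (hz (w - z)) (hlim.mono_left (Ultrafilter.of_le atTop))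
  have e2 := tendsto_nhds_unique (hw (w - z)) (hlim.mono_left hl)
  have e3 : ⟪w - z, w - z⟫ = 0 := by rw [inner_sub_left, e1, e2, sub_self]
  rw [inner_self_eq_zero, sub_eq_zero] at e3
  subst e3
  exact hw y

/-- The inner product of a weakly convergent bounded sequence and a strongly convergent one. -/
theorem tendsto_inner_of_weak_of_strong {l : Filter ℕ} {x g : ℕ → E} {z w : E} {C : ℝ}
    (hC : ∀ n, ‖x n‖ ≤ C) (hx : ∀ y, Tendsto (fun n => ⟪x n, y⟫) l (𝓝 ⟪z, y⟫))
    (hg : Tendsto g l (𝓝 w)) : Tendsto (fun n => ⟪x n, g n⟫) l (𝓝 ⟪z, w⟫) := by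
  have h1 : Tendsto (fun n => ⟪x n, g n - w⟫) l (𝓝 0) := by
    have h0 : Tendsto (fun n => C * ‖g n - w‖) l (𝓝 0) := by
      simpa using (tendsto_iff_norm_sub_tendsto_zero.1 hg).const_mul C
    refine squeeze_zero_norm (fun n => ?_) h0
    exact (norm_inner_le_norm _ _).trans (by gcongr; exact hC n)
  have := h1.add (hx w)
  simpa [inner_sub_right] using this

/-- A forward step `z ↦ z - γ B z` for a `β`-cocoercive operator. -/
theorem norm_sq_forward_sub_le {B : E → E} {β γ : ℝ} (hγ : 0 ≤ γ)
    (hB : ∀ x y, β * ‖B x - B y‖ ^ 2 ≤ ⟪B x - B y, x - y⟫) (x y : E) :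
    ‖(x - γ • B x) - (y - γ • B y)‖ ^ 2 ≤ ‖x - y‖ ^ 2 - γ * (2 * β - γ) * ‖B x - B y‖ ^ 2 := by
  have e : (x - γ • B x) - (y - γ • B y) = (x - y) - γ • (B x - B y) := by
    rw [smul_sub]; abel
  rw [e, norm_sub_sq_real, inner_smul_right, norm_smul, mul_pow, Real.norm_eq_abs, sq_abs,
    real_inner_comm]
  nlinarith [mul_le_mul_of_nonneg_left (hB x y) hγ]

theorem norm_forward_sub_le {B : E → E} {β γ : ℝ} (hγ : 0 ≤ γ) (hγβ : γ ≤ 2 * β)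
    (hB : ∀ x y, β * ‖B x - B y‖ ^ 2 ≤ ⟪B x - B y, x - y⟫) (x y : E) :
    ‖(x - γ • B x) - (y - γ • B y)‖ ≤ ‖x - y‖ := by
  have h := norm_sq_forward_sub_le hγ hB x y
  have : 0 ≤ γ * (2 * β - γ) * ‖B x - B y‖ ^ 2 := by
    have : 0 ≤ 2 * β - γ := by linarith
    positivity
  exact (abs_le_of_sq_le_sq' (by linarith) (norm_nonneg _)).2

/-- Weak convergence of the forward-backward algorithm with summable errors, for a monotone
relation `A` with resolvents `J γ` and a cocoercive operator `B`. -/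
theorem forward_backward_tendsto [CompleteSpace E] {A : E → E → Prop} {J : ℝ → E → E} {B : E → E}
    {β ε : ℝ} (hε : 0 < ε)
    (hA : ∀ x u y v, A x u → A y v → 0 ≤ ⟪x - y, u - v⟫)
    (hJ : ∀ γ, 0 < γ → ∀ u, A (J γ u) (γ⁻¹ • (u - J γ u)))
    (hβ : 0 < β) (hB : ∀ x y, β * ‖B x - B y‖ ^ 2 ≤ ⟪B x - B y, x - y⟫)
    {γ lam : ℕ → ℝ} (hγ : ∀ n, γ n ∈ Set.Icc ε (2 * β - ε))
    (hlam : ∀ n, lam n ∈ Set.Icc 0 (1 - ε)) (hsol : ∃ z, A z (-B z))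
    {x e : ℕ → E} (he : Summable fun n => ‖e n‖)
    (hx : ∀ n, x (n + 1) =
      lam n • x n + (1 - lam n) • J (γ n) (x n - γ n • B (x n)) + e n) :
    ∃ z, A z (-B z) ∧ ∀ y, Tendsto (fun n => ⟪x n, y⟫) atTop (𝓝 ⟪z, y⟫) := by
  have hγ0 : ∀ n, 0 < γ n := fun n => hε.trans_le (hγ n).1
  set p : ℕ → E := fun n => J (γ n) (x n - γ n • B (x n))
  -- Monotonicity of `A` between `p n` and `s` makes the cross term nonnegative when the forward
  -- step difference is split as `p n - s` plus a residual. Cocoercivity supplies the other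
  -- decrease, with `γ n * (2 * β - γ n) ≥ ε ^ 2`.
  have hstep : ∀ s, A s (-B s) → ∀ n, ‖p n - s‖ ^ 2 ≤ ‖x n - s‖ ^ 2
      - ε ^ 2 * ‖B (x n) - B s‖ ^ 2 - ‖x n - p n - γ n • (B (x n) - B s)‖ ^ 2 := by
    intro s hs n
    have h1 := hA _ _ _ _ (hJ (γ n) (hγ0 n) (x n - γ n • B (x n))) hs
    change 0 ≤ ⟪p n - s, (γ n)⁻¹ • (x n - γ n • B (x n) - p n) - -B s⟫ at h1
    have h2 : 0 ≤ ⟪p n - s, x n - p n - γ n • (B (x n) - B s)⟫ := by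
      have := mul_nonneg (hγ0 n).le h1
      rw [← inner_smul_right, smul_sub, smul_inv_smul₀ (hγ0 n).ne'] at this
      have e1 : x n - p n - γ n • (B (x n) - B s) =
          x n - γ n • B (x n) - p n - γ n • -B s := by module
      rwa [e1]
    have h3 := norm_sq_forward_sub_le (hγ0 n).le hB (x n) s
    have h4 : (x n - γ n • B (x n)) - (s - γ n • B s) =
        (p n - s) + (x n - p n - γ n • (B (x n) - B s)) := by module
    rw [h4, norm_add_sq_real] at h3
    have h5 : ε ^ 2 ≤ γ n * (2 * β - γ n) := by
      have h6 := (hγ n).1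
      have h7 : ε ≤ 2 * β - γ n := by linarith [(hγ n).2]
      nlinarith
    have h6 := mul_le_mul_of_nonneg_right h5 (sq_nonneg ‖B (x n) - B s‖)
    linarith
  have hpn : ∀ s, A s (-B s) → ∀ n, ‖p n - s‖ ≤ ‖x n - s‖ := by
    intro s hs n
    refine (abs_le_of_sq_le_sq' ?_ (norm_nonneg _)).2
    have := hstep s hs n
    have : 0 ≤ ε ^ 2 * ‖B (x n) - B s‖ ^ 2 := by positivity
    have : 0 ≤ ‖x n - p n - γ n • (B (x n) - B s)‖ ^ 2 := by positivity
    linarith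
  have hconv : ∀ s, A s (-B s) → ∃ d, Tendsto (fun n => ‖x n - s‖) atTop (𝓝 d) := by
    intro s hs
    refine exists_tendsto_of_le_add_summable (fun n => norm_nonneg _) (fun n => norm_nonneg _) he
      fun n => ?_
    have h1 : x (n + 1) - s = lam n • (x n - s) + (1 - lam n) • (p n - s) + e n := by
      rw [hx n]; module
    have h0 := (hlam n).1
    have h0' : 0 ≤ 1 - lam n := by linarith [(hlam n).2]
    rw [h1]
    calc _ ≤ ‖lam n • (x n - s)‖ + ‖(1 - lam n) • (p n - s)‖ + ‖e n‖ := norm_add₃_le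
      _ = lam n * ‖x n - s‖ + (1 - lam n) * ‖p n - s‖ + ‖e n‖ := by
        rw [norm_smul, norm_smul, Real.norm_of_nonneg h0, Real.norm_of_nonneg h0']
      _ ≤ lam n * ‖x n - s‖ + (1 - lam n) * ‖x n - s‖ + ‖e n‖ := by
        gcongr; exact hpn s hs n
      _ = _ := by ring
  have he0 : Tendsto (fun n => e n) atTop (𝓝 0) :=
    tendsto_zero_iff_norm_tendsto_zero.2 he.tendsto_atTop_zero
  have hdiff : ∀ s, A s (-B s) → Tendsto (fun n => B (x n)) atTop (𝓝 (B s)) ∧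
      Tendsto (fun n => x n - p n) atTop (𝓝 0) := by
    intro s hs
    obtain ⟨d, hd⟩ := hconv s hs
    -- Removing `e n` leaves an exact convex combination of `x n - s` and `p n - s`, whose norm can
    -- be squared without error terms.
    have hd' : Tendsto (fun n => ‖x (n + 1) - s - e n‖) atTop (𝓝 d) := by
      have h1 : Tendsto (fun n => ‖x (n + 1) - s‖) atTop (𝓝 d) :=
        hd.comp (tendsto_add_atTop_nat 1)
      have h2 : Tendsto (fun n => ‖x (n + 1) - s - e n‖ - ‖x (n + 1) - s‖) atTop (𝓝 0) := by
        refine squeeze_zero_norm (fun n => ?_) he.tendsto_atTop_zero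
        refine (abs_norm_sub_norm_le _ _).trans ?_
        simp
      simpa using h2.add h1
    -- The factor `ε⁻¹` compensates for the weight `1 - lam n ≥ ε` carried by the decrease in
    -- `hstep`.
    have hq : Tendsto (fun n => ε⁻¹ * (‖x n - s‖ ^ 2 - ‖x (n + 1) - s - e n‖ ^ 2)) atTop
        (𝓝 0) := by
      simpa using ((hd.pow 2).sub (hd'.pow 2)).const_mul ε⁻¹
    have hle : ∀ n, ε ^ 2 * ‖B (x n) - B s‖ ^ 2 + ‖x n - p n - γ n • (B (x n) - B s)‖ ^ 2 ≤
        ε⁻¹ * (‖x n - s‖ ^ 2 - ‖x (n + 1) - s - e n‖ ^ 2) := by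
      intro n
      have h1 : x (n + 1) - s - e n = lam n • (x n - s) + (1 - lam n) • (p n - s) := by
        rw [hx n]; module
      have h0 := (hlam n).1
      have h0' : ε ≤ 1 - lam n := by linarith [(hlam n).2]
      have h2 : ‖x (n + 1) - s - e n‖ ≤ lam n * ‖x n - s‖ + (1 - lam n) * ‖p n - s‖ := by
        rw [h1]
        refine (norm_add_le _ _).trans_eq ?_
        rw [norm_smul, norm_smul, Real.norm_of_nonneg h0, Real.norm_of_nonneg (hε.le.trans h0')]
      have h3 : ‖x (n + 1) - s - e n‖ ^ 2 ≤
          lam n * ‖x n - s‖ ^ 2 + (1 - lam n) * ‖p n - s‖ ^ 2 := by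
        have := pow_le_pow_left₀ (norm_nonneg _) h2 2
        nlinarith [mul_nonneg (mul_nonneg h0 (hε.le.trans h0')) (sq_nonneg (‖x n - s‖ - ‖p n - s‖))]
      have h4 := hstep s hs n
      rw [le_inv_mul_iff₀ hε]
      have h5 : 0 ≤ ε ^ 2 * ‖B (x n) - B s‖ ^ 2 + ‖x n - p n - γ n • (B (x n) - B s)‖ ^ 2 := by
        positivity
      have h6 := mul_le_mul_of_nonneg_right h0' h5
      nlinarith
    have hB0 : Tendsto (fun n => B (x n) - B s) atTop (𝓝 0) := by
      have h1 : Tendsto (fun n => ‖B (x n) - B s‖ ^ 2) atTop (𝓝 0) := by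
        have h2 := hq.const_mul (ε ^ 2)⁻¹
        rw [mul_zero] at h2
        refine squeeze_zero (fun n => sq_nonneg _) (fun n => ?_) h2
        rw [le_inv_mul_iff₀ (by positivity)]
        have := hle n
        have : 0 ≤ ‖x n - p n - γ n • (B (x n) - B s)‖ ^ 2 := by positivity
        linarith
      refine tendsto_zero_iff_norm_tendsto_zero.2 ?_
      simpa using h1.sqrt
    refine ⟨by simpa using hB0.add_const (B s), ?_⟩
    have h1 : Tendsto (fun n => x n - p n - γ n • (B (x n) - B s)) atTop (𝓝 0) := by
      have h2 : Tendsto (fun n => ‖x n - p n - γ n • (B (x n) - B s)‖ ^ 2) atTop (𝓝 0) := by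
        refine squeeze_zero (fun n => sq_nonneg _) (fun n => ?_) hq
        have := hle n
        have : 0 ≤ ε ^ 2 * ‖B (x n) - B s‖ ^ 2 := by positivity
        linarith
      refine tendsto_zero_iff_norm_tendsto_zero.2 ?_
      simpa using h2.sqrt
    have h2 : Tendsto (fun n => γ n • (B (x n) - B s)) atTop (𝓝 0) := by
      have h3 := hB0.norm.const_mul (2 * β)
      rw [norm_zero, mul_zero] at h3
      refine squeeze_zero_norm (fun n => ?_) h3
      rw [norm_smul, Real.norm_of_nonneg (hγ0 n).le]
      gcongr
      linarith [(hγ n).2]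
    simpa using h1.add h2
  obtain ⟨s, hs⟩ := hsol
  obtain ⟨hBs, hxp⟩ := hdiff s hs
  obtain ⟨C, hC⟩ : ∃ C, ∀ n, ‖x n - s‖ ≤ C := by
    obtain ⟨d, hd⟩ := hconv s hs
    obtain ⟨C, hC⟩ := hd.bddAbove_range
    exact ⟨C, fun n => hC ⟨n, rfl⟩⟩
  refine opial (S := {z | A z (-B z)}) ⟨s, hs⟩ hconv fun l z hl hz => ?_
  have hxz : ∀ y, Tendsto (fun n => ⟪x n - z, y⟫) l (𝓝 ⟪(0 : E), y⟫) := fun y => by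
    simpa [inner_sub_left] using (hz y).sub_const ⟪z, y⟫
  have hCz : ∀ n, ‖x n - z‖ ≤ C + ‖s - z‖ := fun n => by
    have := norm_sub_le_norm_sub_add_norm_sub (x n) s z
    linarith [hC n]
  -- Cocoercivity passes to the limit: `B (x n) - B z` converges strongly while `x n - z` tends
  -- weakly to 0, so their inner product vanishes.
  have hBz : B z = B s := by
    have h1 := tendsto_inner_of_weak_of_strong hCz hxz ((hBs.mono_left hl).sub_const (B z))
    have h2 : Tendsto (fun n => β * ‖B (x n) - B z‖ ^ 2) l (𝓝 (β * ‖B s - B z‖ ^ 2)) :=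
      ((((hBs.mono_left hl).sub_const (B z)).norm).pow 2).const_mul β
    have h3 := le_of_tendsto_of_tendsto h2 h1 (Eventually.of_forall fun n => by
      dsimp only
      rw [real_inner_comm]
      exact hB (x n) z)
    rw [inner_zero_left] at h3
    have h4 : ‖B s - B z‖ ^ 2 ≤ 0 := by
      by_contra! h
      nlinarith [mul_pos hβ h]
    have h5 : ‖B s - B z‖ = 0 := by
      have := sq_nonneg ‖B s - B z‖
      exact pow_eq_zero_iff two_ne_zero |>.1 (le_antisymm h4 this)
    exact (sub_eq_zero.1 (norm_eq_zero.1 h5)).symm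
  -- maximal monotonicity, through the resolvent `J 1`
  set q := J 1 (z - B z)
  have hqA : A q (z - B z - q) := by
    simpa using hJ 1 one_pos (z - B z)
  set g : ℕ → E := fun n => (γ n)⁻¹ • (x n - p n) - B (x n) with hg
  have hgA : ∀ n, A (p n) (g n) := fun n => by
    have := hJ (γ n) (hγ0 n) (x n - γ n • B (x n))
    convert this using 1
    simp only [hg]
    rw [sub_right_comm, smul_sub _ (x n - p n), inv_smul_smul₀ (hγ0 n).ne']
  have hglim : Tendsto g atTop (𝓝 (-B z)) := by
    have h1 : Tendsto (fun n => (γ n)⁻¹ • (x n - p n)) atTop (𝓝 0) := by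
      have h2 := hxp.norm.const_mul ε⁻¹
      rw [norm_zero, mul_zero] at h2
      refine squeeze_zero_norm (fun n => ?_) h2
      rw [norm_smul, norm_inv, Real.norm_of_nonneg (hγ0 n).le]
      gcongr
      exact (hγ n).1
    rw [hBz]
    simpa using h1.sub hBs
  have hpz : ∀ y, Tendsto (fun n => ⟪p n - q, y⟫) l (𝓝 ⟪z - q, y⟫) := fun y => by
    have h1 : Tendsto (fun n => ⟪x n - p n, y⟫) l (𝓝 0) := by
      simpa using (hxp.mono_left hl).inner (tendsto_const_nhds (x := y))
    have h2 := ((hz y).sub h1).sub_const ⟪q, y⟫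
    simpa [inner_sub_left] using h2
  have hpC : ∀ n, ‖p n - q‖ ≤ C + ‖s - q‖ := fun n => by
    have := norm_sub_le_norm_sub_add_norm_sub (p n) s q
    linarith [hC n, hpn s hs n]
  have hlim := tendsto_inner_of_weak_of_strong hpC hpz
    ((hglim.mono_left hl).sub_const (z - B z - q))
  -- In the limit, monotonicity between `(p n, g n)` and `(q, z - B z - q)` reads `0 ≤ -‖z - q‖ ^
  -- 2`.
  have h0 := ge_of_tendsto hlim (Eventually.of_forall fun n => hA _ _ _ _ (hgA n) hqA)
  have h1 : -B z - (z - B z - q) = -(z - q) := by abel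
  rw [h1, inner_neg_right, real_inner_self_eq_norm_sq] at h0
  have h2 : ‖z - q‖ = 0 := pow_eq_zero_iff two_ne_zero |>.1 (by
    have := sq_nonneg ‖z - q‖
    linarith)
  have h3 : z = q := sub_eq_zero.1 (norm_eq_zero.1 h2)
  change A z (-B z)
  rw [← h3] at hqA
  simpa using hqA

end ForwardBackward

/-! ### Proximity operators and subdifferentials -/

section Prox

variable {H : Type*} [NormedAddCommGroup H] [InnerProductSpace ℝ H]

/-- `g` is a subgradient of the extended real valued function `f` at `q`. -/
def IsSubgradientAt (f : H → EReal) (q g : H) : Prop :=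
  ∀ y, f q + ((⟪y - q, g⟫ : ℝ) : EReal) ≤ f y

namespace GammaZero

variable {f : H → EReal}

theorem exists_coe (hf : GammaZero f) {x : H} (hx : f x ≠ ⊤) : ∃ r : ℝ, f x = r :=
  ⟨(f x).toReal, (EReal.coe_toReal hx (hf.ne_bot x)).symm⟩

/-- Finite endpoint values force a finite value in between, so later convexity arguments run in `ℝ`
instead of `EReal`. -/
theorem combo_le (hf : GammaZero f) {x y : H} {r s t : ℝ} (hx : f x = r) (hy : f y = s)
    (ht : 0 < t) (ht1 : t < 1) :
    ∃ u : ℝ, f ((1 - t) • x + t • y) = u ∧ u ≤ (1 - t) * r + t * s := by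
  have h := hf.convex x y (1 - t) t (by linarith) ht (by ring)
  rw [hx, hy, ← EReal.coe_mul, ← EReal.coe_mul, ← EReal.coe_add] at h
  obtain ⟨u, hu⟩ := hf.exists_coe (ne_top_of_le_ne_top (EReal.coe_ne_top _) h)
  rw [hu] at h
  exact ⟨u, hu, EReal.coe_le_coe_iff.1 h⟩

theorem const_mul (hf : GammaZero f) {γ : ℝ} (hγ : 0 < γ) :
    GammaZero fun z => (γ : EReal) * f z := by
  have hγ' : (0 : EReal) < γ := EReal.coe_pos.2 hγ
  have hbot : ∀ x, (γ : EReal) * f x ≠ ⊥ := by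
    intro x
    by_cases hx : f x = ⊤
    · rw [hx, EReal.coe_mul_top_of_pos hγ]; exact top_ne_bot
    · obtain ⟨r, hr⟩ := hf.exists_coe hx
      rw [hr, ← EReal.coe_mul]; exact EReal.coe_ne_bot _
  refine ⟨hbot, ?_, ?_, ?_⟩
  · obtain ⟨x, hx⟩ := hf.proper
    obtain ⟨r, hr⟩ := hf.exists_coe hx.ne
    exact ⟨x, by rw [hr, ← EReal.coe_mul]; exact EReal.coe_lt_top _⟩
  · rw [lowerSemicontinuous_iff_isClosed_preimage]
    intro c
    convert hf.lsc.isClosed_preimage (c / γ) using 1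
    ext z
    simp only [Set.mem_preimage, Set.mem_Iic]
    rw [EReal.le_div_iff_mul_le hγ' (EReal.coe_ne_top _), mul_comm]
  · intro x y a b ha hb hab
    have hbot' : ∀ (c : ℝ) z, 0 < c → (c : EReal) * ((γ : EReal) * f z) ≠ ⊥ := by
      intro c z hc
      by_cases hz : f z = ⊤
      · rw [hz, EReal.coe_mul_top_of_pos hγ, EReal.coe_mul_top_of_pos hc]; exact top_ne_bot
      · obtain ⟨r, hr⟩ := hf.exists_coe hz
        rw [hr, ← EReal.coe_mul, ← EReal.coe_mul]; exact EReal.coe_ne_bot _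
    by_cases hx : f x = ⊤
    · rw [hx, EReal.coe_mul_top_of_pos hγ, EReal.coe_mul_top_of_pos ha,
        EReal.top_add_of_ne_bot (hbot' b y hb)]
      exact le_top
    by_cases hy : f y = ⊤
    · rw [hy, EReal.coe_mul_top_of_pos hγ, EReal.coe_mul_top_of_pos hb,
        EReal.add_top_of_ne_bot (hbot' a x ha)]
      exact le_top
    obtain ⟨r, hr⟩ := hf.exists_coe hx
    obtain ⟨s, hs⟩ := hf.exists_coe hy
    obtain ⟨u, hu, hle⟩ := hf.combo_le hr hs hb (by linarith)
    obtain rfl : a = 1 - b := by linarith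
    simp only [hu, hr, hs]
    norm_cast
    nlinarith

/-- Lower semicontinuity bounds `f` below on a ball around a point of its domain, and convexity
along segments from that point propagates the bound with linear loss. This replaces an affine
minorant from Hahn-Banach. -/
theorem exists_lower_bound (hf : GammaZero f) :
    ∃ (x₀ : H) (c δ : ℝ), 0 < δ ∧ ∀ y (s : ℝ), f y = s → c - ‖y - x₀‖ / δ ≤ s := by
  obtain ⟨x₀, hx₀⟩ := hf.proper
  obtain ⟨r, hr⟩ := hf.exists_coe hx₀.ne
  have h1 : ((r - 1 : ℝ) : EReal) < f x₀ := by
    rw [hr]; exact EReal.coe_lt_coe_iff.2 (by linarith)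
  obtain ⟨δ, hδ, hball⟩ := Metric.eventually_nhds_iff.1 (hf.lsc x₀ _ h1)
  refine ⟨x₀, r - 2, δ, hδ, fun y s hs => ?_⟩
  set d := ‖y - x₀‖ with hd
  have hd0 : 0 ≤ d := norm_nonneg _
  have hpos : 0 < 2 * δ + d := by linarith
  -- Chosen so that `t * d < δ`, which keeps the convex combination in the ball, and `1 / t = 2 + d
  -- / δ`.
  set t := δ / (2 * δ + d) with ht
  have ht0 : 0 < t := by positivity
  have ht1 : t < 1 := by rw [ht, div_lt_one hpos]; linarith
  obtain ⟨u, hu, hle⟩ := hf.combo_le hr hs ht0 ht1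
  have h2 : dist ((1 - t) • x₀ + t • y) x₀ < δ := by
    have : (1 - t) • x₀ + t • y - x₀ = t • (y - x₀) := by module
    rw [dist_eq_norm, this, norm_smul, Real.norm_of_nonneg ht0.le, ← hd, ht, div_mul_eq_mul_div,
      div_lt_iff₀ hpos]
    nlinarith
  have h3 : ((r - 1 : ℝ) : EReal) < f ((1 - t) • x₀ + t • y) := hball h2
  rw [hu, EReal.coe_lt_coe_iff] at h3
  have h4 : t * (r - 2 - d / δ) ≤ t * s := by
    have : t * (2 + d / δ) = 1 := by
      rw [ht]; field_simp
    nlinarith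
  exact le_of_mul_le_mul_left h4 ht0

/-- The quadratic term is strongly convex, so minimizing sequences are Cauchy; lower semicontinuity
makes their limit a minimizer. -/
theorem exists_isProx [CompleteSpace H] (hf : GammaZero f) (x : H) : ∃ q, IsProx f x q := by
  obtain ⟨x₀, c, δ, hδ, hlow⟩ := hf.exists_lower_bound
  set V : Set ℝ := {v | ∃ y, ∃ s : ℝ, f y = s ∧ v = s + ‖x - y‖ ^ 2 / 2} with hV
  have hVne : V.Nonempty := by
    obtain ⟨y, hy⟩ := hf.proper
    obtain ⟨s, hs⟩ := hf.exists_coe hy.ne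
    exact ⟨_, y, s, hs, rfl⟩
  have hVb : BddBelow V := by
    -- The last term comes from completing the square in `‖x - y‖ ^ 2 / 2 - ‖x - y‖ / δ`.
    refine ⟨c - ‖x - x₀‖ / δ - 1 / (2 * δ ^ 2), ?_⟩
    rintro _ ⟨y, s, hs, rfl⟩
    have h1 := hlow y s hs
    have h2 : ‖y - x₀‖ / δ ≤ ‖x - y‖ / δ + ‖x - x₀‖ / δ := by
      rw [← add_div]
      gcongr
      have := norm_sub_le_norm_sub_add_norm_sub y x x₀
      rwa [norm_sub_rev y x] at this
    have h3 : 0 ≤ (‖x - y‖ - 1 / δ) ^ 2 / 2 := by positivity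
    have h4 : (‖x - y‖ - 1 / δ) ^ 2 / 2 =
        ‖x - y‖ ^ 2 / 2 - ‖x - y‖ / δ + 1 / (2 * δ ^ 2) := by
      field_simp; ring
    linarith
  set m := sInf V with hm
  have hex : ∀ n : ℕ, ∃ y, ∃ s : ℝ, f y = s ∧ s + ‖x - y‖ ^ 2 / 2 < m + 1 / ((n : ℝ) + 1) := by
    intro n
    obtain ⟨_, ⟨y, s, hs, rfl⟩, h⟩ := exists_lt_of_csInf_lt hVne
      (show sInf V < m + 1 / ((n : ℝ) + 1) by
        rw [← hm]; exact lt_add_of_pos_right _ (by positivity))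
    exact ⟨y, s, hs, h⟩
  choose y s hs hlt using hex
  have hCS : CauchySeq y := by
    -- The parallelogram identity at the midpoint of `y n` and `y k` leaves `‖y n - y k‖ ^ 2 / 8`
    -- below the minimization gap `1 / (N + 1)`.
    refine cauchySeq_of_le_tendsto_0 (fun N : ℕ => √(8 * (1 / ((N : ℝ) + 1)))) ?_ ?_
    · intro n k N hn hk
      obtain ⟨u, hu, hle⟩ := hf.combo_le (hs n) (hs k) (t := 1 / 2) (by norm_num) (by norm_num)
      have h1 : m ≤ u + ‖x - ((1 - 1 / 2 : ℝ) • y n + (1 / 2 : ℝ) • y k)‖ ^ 2 / 2 :=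
        csInf_le hVb ⟨_, u, hu, rfl⟩
      have h2 : x - ((1 - 1 / 2 : ℝ) • y n + (1 / 2 : ℝ) • y k) =
          (1 / 2 : ℝ) • ((x - y n) + (x - y k)) := by module
      have h3 : ‖y n - y k‖ ^ 2 = ‖(x - y n) - (x - y k)‖ ^ 2 := by
        rw [sub_sub_sub_cancel_left, norm_sub_rev]
      rw [h2, norm_smul, mul_pow, norm_add_sq_real] at h1
      rw [norm_sub_sq_real (x - y n)] at h3
      have h4 : 1 / ((n : ℝ) + 1) ≤ 1 / ((N : ℝ) + 1) := by gcongr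
      have h5 : 1 / ((k : ℝ) + 1) ≤ 1 / ((N : ℝ) + 1) := by gcongr
      have h6 := hlt n
      have h7 := hlt k
      norm_num at h1
      rw [dist_eq_norm]
      refine Real.le_sqrt_of_sq_le ?_
      linarith
    · have := (tendsto_one_div_add_atTop_nhds_zero_nat (𝕜 := ℝ)).const_mul 8
      simpa using this.sqrt
  obtain ⟨q, hq⟩ := cauchySeq_tendsto_of_complete hCS
  have hfq : f q ≤ ((m - ‖x - q‖ ^ 2 / 2 : ℝ) : EReal) := by
    refine EReal.le_of_forall_lt_iff_le.1 fun c hc => ?_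
    have hc' := EReal.coe_lt_coe_iff.1 hc
    have hlim : Tendsto (fun n : ℕ => m + 1 / ((n : ℝ) + 1) - ‖x - y n‖ ^ 2 / 2) atTop
        (𝓝 (m - ‖x - q‖ ^ 2 / 2)) := by
      have h1 := (tendsto_one_div_add_atTop_nhds_zero_nat (𝕜 := ℝ)).const_add m
      have h2 := (((hq.const_sub x).norm).pow 2).div_const 2
      simpa using h1.sub h2
    refine (hf.lsc.isClosed_preimage c).mem_of_tendsto hq ?_
    filter_upwards [hlim.eventually_lt_const hc'] with n hn
    rw [Set.mem_preimage, Set.mem_Iic, hs n, EReal.coe_le_coe_iff]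
    linarith [hlt n]
  refine ⟨q, fun z _ => ?_⟩
  change _ ≤ f z + ((‖x - z‖ ^ 2 / 2 : ℝ) : EReal)
  have h1 : f q + ((‖x - q‖ ^ 2 / 2 : ℝ) : EReal) ≤ (m : EReal) := by
    refine (add_le_add_left hfq _).trans_eq ?_
    rw [← EReal.coe_add, sub_add_cancel]
  refine h1.trans ?_
  by_cases hz : f z = ⊤
  · rw [hz, EReal.top_add_coe]; exact le_top
  · obtain ⟨u, hu⟩ := hf.exists_coe hz
    rw [hu, ← EReal.coe_add, EReal.coe_le_coe_iff]
    exact csInf_le hVb ⟨z, u, hu, rfl⟩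

theorem isProx_prox [CompleteSpace H] (hf : GammaZero f) (x : H) : IsProx f x (prox f x) :=
  Classical.epsilon_spec (hf.exists_isProx x)

theorem ne_top_of_isSubgradientAt (hf : GammaZero f) {q g : H} (h : IsSubgradientAt f q g) :
    f q ≠ ⊤ := by
  intro hq
  obtain ⟨y, hy⟩ := hf.proper
  have := h y
  rw [hq, EReal.top_add_coe] at this
  exact (this.trans_lt hy).ne rfl

/-- Compare `q` with `(1 - t) • q + t • y`, divide by `t` and let `t` tend to 0; the quadratic
remainder disappears. -/
theorem isSubgradientAt_of_isProx (hf : GammaZero f) {x q : H} (h : IsProx f x q) :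
    IsSubgradientAt f q (x - q) := by
  have hmin : ∀ y, f q + ((‖x - q‖ ^ 2 / 2 : ℝ) : EReal) ≤ f y + ((‖x - y‖ ^ 2 / 2 : ℝ) : EReal) :=
    fun y => h (Set.mem_univ y)
  have hq : f q ≠ ⊤ := by
    intro hq
    obtain ⟨y, hy⟩ := hf.proper
    obtain ⟨s, hs⟩ := hf.exists_coe hy.ne
    have := hmin y
    rw [hq, EReal.top_add_coe, hs, ← EReal.coe_add] at this
    exact EReal.coe_ne_top _ (top_le_iff.1 this)
  obtain ⟨r, hr⟩ := hf.exists_coe hq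
  intro y
  by_cases hy : f y = ⊤
  · rw [hy]; exact le_top
  obtain ⟨s, hs⟩ := hf.exists_coe hy
  rw [hr, hs, ← EReal.coe_add, EReal.coe_le_coe_iff]
  have key : ∀ t ∈ Set.Ioo (0 : ℝ) 1, r + ⟪y - q, x - q⟫ ≤ s + t * (‖y - q‖ ^ 2 / 2) := by
    rintro t ⟨ht0, ht1⟩
    obtain ⟨u, hu, hle⟩ := hf.combo_le hr hs ht0 ht1
    have h1 := hmin ((1 - t) • q + t • y)
    rw [hr, hu, ← EReal.coe_add, ← EReal.coe_add, EReal.coe_le_coe_iff] at h1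
    have h2 : x - ((1 - t) • q + t • y) = (x - q) - t • (y - q) := by module
    rw [h2, norm_sub_sq_real (x - q), inner_smul_right, norm_smul, mul_pow, Real.norm_eq_abs, sq_abs,
      real_inner_comm] at h1
    have h3 : t * (r + ⟪y - q, x - q⟫) ≤ t * (s + t * (‖y - q‖ ^ 2 / 2)) := by nlinarith
    exact le_of_mul_le_mul_left h3 ht0
  have hlim : Tendsto (fun t : ℝ => s + t * (‖y - q‖ ^ 2 / 2)) (𝓝[>] 0) (𝓝 s) := by
    have : Continuous fun t : ℝ => s + t * (‖y - q‖ ^ 2 / 2) := by fun_prop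
    simpa using (this.tendsto 0).mono_left nhdsWithin_le_nhds
  exact ge_of_tendsto hlim (by
    filter_upwards [Ioo_mem_nhdsGT (zero_lt_one' ℝ)] with t ht using key t ht)

/-- The subdifferential of a function is monotone. -/
theorem inner_nonneg_of_isSubgradientAt (hf : GammaZero f) {x u y v : H}
    (hx : IsSubgradientAt f x u) (hy : IsSubgradientAt f y v) : 0 ≤ ⟪x - y, u - v⟫ := by
  obtain ⟨r, hr⟩ := hf.exists_coe (hf.ne_top_of_isSubgradientAt hx)
  obtain ⟨s, hs⟩ := hf.exists_coe (hf.ne_top_of_isSubgradientAt hy)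
  have h1 := hx y
  have h2 := hy x
  rw [hr, hs, ← EReal.coe_add, EReal.coe_le_coe_iff] at h1 h2
  rw [← neg_sub, inner_neg_left] at h1
  rw [inner_sub_right]
  linarith

theorem isSubgradientAt_of_const_mul (hf : GammaZero f) {γ : ℝ} (hγ : 0 < γ) {q g : H}
    (h : IsSubgradientAt (fun z => (γ : EReal) * f z) q g) : IsSubgradientAt f q (γ⁻¹ • g) := by
  have hq : f q ≠ ⊤ := by
    intro hq
    apply (hf.const_mul hγ).ne_top_of_isSubgradientAt h
    simp [hq, EReal.coe_mul_top_of_pos hγ]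
  obtain ⟨r, hr⟩ := hf.exists_coe hq
  intro y
  by_cases hy : f y = ⊤
  · rw [hy]; exact le_top
  obtain ⟨s, hs⟩ := hf.exists_coe hy
  have h1 := h y
  dsimp only at h1
  rw [hr, hs, ← EReal.coe_mul, ← EReal.coe_mul, ← EReal.coe_add, EReal.coe_le_coe_iff] at h1
  rw [hr, hs, ← EReal.coe_add, EReal.coe_le_coe_iff, inner_smul_right]
  have h2 : γ * (r + γ⁻¹ * ⟪y - q, g⟫) ≤ γ * s := by
    rw [mul_add, mul_inv_cancel_left₀ hγ.ne']
    exact h1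
  exact le_of_mul_le_mul_left h2 hγ

theorem isSubgradientAt_prox_const_mul [CompleteSpace H] (hf : GammaZero f) {γ : ℝ} (hγ : 0 < γ)
    (x : H) : IsSubgradientAt f (prox (fun z => (γ : EReal) * f z) x)
      (γ⁻¹ • (x - prox (fun z => (γ : EReal) * f z) x)) :=
  hf.isSubgradientAt_of_const_mul hγ
    ((hf.const_mul hγ).isSubgradientAt_of_isProx ((hf.const_mul hγ).isProx_prox x))

/-- Monotonicity gives `‖p - q‖ ^ 2 ≤ ⟪p - q, x - y⟫`, and Cauchy-Schwarz finishes. Applied to the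
approximate functions, it keeps errors from being amplified. -/
theorem norm_prox_sub_le [CompleteSpace H] (hf : GammaZero f) (x y : H) :
    ‖prox f x - prox f y‖ ≤ ‖x - y‖ := by
  have h := hf.inner_nonneg_of_isSubgradientAt
    (hf.isSubgradientAt_of_isProx (hf.isProx_prox x))
    (hf.isSubgradientAt_of_isProx (hf.isProx_prox y))
  set p := prox f x
  set q := prox f y
  have h1 : x - p - (y - q) = (x - y) - (p - q) := by abel
  rw [h1, inner_sub_right, real_inner_self_eq_norm_sq] at h
  have h2 := real_inner_le_norm (p - q) (x - y)
  by_contra! h3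
  nlinarith [norm_nonneg (x - y), norm_nonneg (p - q)]

end GammaZero

end Prox

/-! ### Convex functions with Lipschitz gradient -/

section BaillonHaddad

variable {G : Type*} [NormedAddCommGroup G] [InnerProductSpace ℝ G] [CompleteSpace G]
  {φ : G → ℝ} {τ : ℝ}

theorem hasDerivAt_comp_line (hd : Differentiable ℝ φ) (x v : G) (t : ℝ) :
    HasDerivAt (fun t : ℝ => φ (x + t • v)) ⟪gradient φ (x + t • v), v⟫ t := by
  have h1 : HasDerivAt (fun t : ℝ => x + t • v) v t := by
    simpa using ((hasDerivAt_id t).smul_const v).const_add x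
  have h2 := ((hd (x + t • v)).hasGradientAt.hasFDerivAt).comp_hasDerivAt t h1
  exact h2

/-- The gradient inequality for convex differentiable functions. -/
theorem ConvexOn.add_inner_gradient_le (hc : ConvexOn ℝ Set.univ φ) (hd : Differentiable ℝ φ)
    (x y : G) : φ x + ⟪gradient φ x, y - x⟫ ≤ φ y := by
  have h1 := hasDerivAt_comp_line hd x (y - x) 0
  rw [zero_smul, add_zero] at h1
  have h2 : Tendsto (fun t : ℝ => t⁻¹ • (φ (x + (0 + t) • (y - x)) - φ (x + (0 : ℝ) • (y - x))))
      (𝓝[>] 0) (𝓝 ⟪gradient φ x, y - x⟫) := h1.tendsto_slope_zero_right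
  have h3 : ⟪gradient φ x, y - x⟫ ≤ φ y - φ x := by
    refine le_of_tendsto h2 ?_
    filter_upwards [Ioo_mem_nhdsGT (zero_lt_one' ℝ)] with t ht
    have h4 := hc.2 (Set.mem_univ x) (Set.mem_univ y)
      (sub_nonneg.2 ht.2.le) ht.1.le (sub_add_cancel 1 t)
    have h5 : x + (0 + t) • (y - x) = (1 - t) • x + t • y := by module
    rw [h5, zero_smul, add_zero, smul_eq_mul, inv_mul_le_iff₀ ht.1]
    simp only [smul_eq_mul] at h4
    linarith
  linarith

namespace LipschitzDifferentiable

/-- The descent lemma. -/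
theorem le_add_inner_add (h : LipschitzDifferentiable τ φ) (x y : G) :
    φ y ≤ φ x + ⟪gradient φ x, y - x⟫ + τ / 2 * ‖y - x‖ ^ 2 := by
  set v := y - x with hv
  have hderiv : ∀ t : ℝ, HasDerivAt
      (fun t : ℝ => φ (x + t • v) - t * ⟪gradient φ x, v⟫ - τ / 2 * ‖v‖ ^ 2 * t ^ 2)
      (⟪gradient φ (x + t • v), v⟫ - ⟪gradient φ x, v⟫ - τ * ‖v‖ ^ 2 * t) t := by
    intro t
    have h1 := ((hasDerivAt_comp_line h.1 x v t).sub
      ((hasDerivAt_id t).mul_const ⟪gradient φ x, v⟫)).sub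
      ((hasDerivAt_pow 2 t).const_mul (τ / 2 * ‖v‖ ^ 2))
    refine h1.congr_deriv ?_
    simp only [Nat.cast_ofNat, Nat.add_one_sub_one, pow_one]
    ring
  have hanti : AntitoneOn
      (fun t : ℝ => φ (x + t • v) - t * ⟪gradient φ x, v⟫ - τ / 2 * ‖v‖ ^ 2 * t ^ 2)
      (Set.Icc 0 1) := by
    refine antitoneOn_of_deriv_nonpos (convex_Icc 0 1)
      (fun t _ => (hderiv t).continuousAt.continuousWithinAt)
      (fun t _ => (hderiv t).differentiableAt.differentiableWithinAt) fun t ht => ?_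
    rw [interior_Icc] at ht
    rw [(hderiv t).deriv, ← inner_sub_left]
    have h1 := real_inner_le_norm (gradient φ (x + t • v) - gradient φ x) v
    have h2 := h.2 (x + t • v) x
    rw [add_sub_cancel_left, norm_smul, Real.norm_of_nonneg ht.1.le] at h2
    have h3 := mul_le_mul_of_nonneg_right h2 (norm_nonneg v)
    nlinarith
  have := hanti (Set.left_mem_Icc.2 zero_le_one) (Set.right_mem_Icc.2 zero_le_one) zero_le_one
  simp only [one_smul, zero_smul, add_zero, one_mul, zero_mul, one_pow, mul_one, mul_zero,
    sub_zero, zero_pow two_ne_zero] at this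
  rw [hv, add_sub_cancel] at this
  linarith

/-- The Baillon-Haddad theorem: a `τ`-Lipschitz gradient of a convex function is
`1/τ`-cocoercive. -/
theorem norm_gradient_sub_sq_le (h : LipschitzDifferentiable τ φ) (hc : ConvexOn ℝ Set.univ φ)
    (hτ : 0 < τ) (x y : G) :
    τ⁻¹ * ‖gradient φ x - gradient φ y‖ ^ 2 ≤ ⟪gradient φ x - gradient φ y, x - y⟫ := by
  have key : ∀ x y, φ x + ⟪gradient φ x, y - x⟫ +
      τ⁻¹ / 2 * ‖gradient φ y - gradient φ x‖ ^ 2 ≤ φ y := by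
    intro x y
    set d := gradient φ y - gradient φ x with hd
    -- The point `y - τ⁻¹ • d` minimizes the quadratic upper bound at `y` of `φ` minus its linear
    -- part at `x`.
    have h1 := hc.add_inner_gradient_le h.1 x (y - τ⁻¹ • d)
    have h2 := h.le_add_inner_add y (y - τ⁻¹ • d)
    have e1 : y - τ⁻¹ • d - y = -(τ⁻¹ • d) := by abel
    have e2 : y - τ⁻¹ • d - x = (y - x) - τ⁻¹ • d := by abel
    have e3 : ⟪gradient φ y, d⟫ = ⟪gradient φ x, d⟫ + ‖d‖ ^ 2 := by
      rw [← real_inner_self_eq_norm_sq, ← inner_add_left]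
      congr 1
      rw [hd]; abel
    rw [e1, norm_neg, norm_smul, mul_pow, inner_neg_right, inner_smul_right, e3, norm_inv,
      Real.norm_of_nonneg hτ.le] at h2
    rw [e2, inner_sub_right, inner_smul_right] at h1
    have e4 : τ / 2 * (τ⁻¹ ^ 2 * ‖d‖ ^ 2) = τ⁻¹ / 2 * ‖d‖ ^ 2 := by
      field_simp
    linarith
  have h1 := key x y
  have h2 := key y x
  rw [norm_sub_rev (gradient φ y)] at h1
  rw [← neg_sub x y, inner_neg_right] at h1
  rw [inner_sub_left]
  linarith

end LipschitzDifferentiable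

end BaillonHaddad

/-! ### Cocoercivity of the coupling operator -/

section Coupling

variable {m p : ℕ} {H : Fin m → Type*} {G : Fin p → Type*}
    [∀ i, NormedAddCommGroup (H i)] [∀ i, InnerProductSpace ℝ (H i)]
    [∀ k, NormedAddCommGroup (G k)] [∀ k, InnerProductSpace ℝ (G k)]
    {φ : ∀ k, G k → ℝ} {τ : Fin p → ℝ} {L : ∀ k i, H i →L[ℝ] G k}

theorem betaConst_pos (hp : 1 ≤ p) (hτ : ∀ k, 0 < τ k) (hL : ∀ k, 0 < ∑ i, ‖L k i‖ ^ 2) :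
    0 < betaConst τ L := by
  have h1 := le_ciSup (Set.finite_range fun k => τ k * ∑ i, ‖L k i‖ ^ 2).bddAbove ⟨0, hp⟩
  have h2 := mul_pos (hτ ⟨0, hp⟩) (hL ⟨0, hp⟩)
  have h3 : (0 : ℝ) < p := by exact_mod_cast hp
  exact one_div_pos.2 (mul_pos h3 (h2.trans_le h1))

theorem betaConst_mul_le (hp : 1 ≤ p) (hτ : ∀ k, 0 < τ k) (hL : ∀ k, 0 < ∑ i, ‖L k i‖ ^ 2)
    (k : Fin p) : betaConst τ L * (p * (τ k * ∑ i, ‖L k i‖ ^ 2)) ≤ 1 := by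
  have h1 := le_ciSup (Set.finite_range fun k => τ k * ∑ i, ‖L k i‖ ^ 2).bddAbove k
  have h2 := mul_pos (hτ k) (hL k)
  have h3 : (0 : ℝ) < p := by exact_mod_cast hp
  rw [betaConst, one_div, inv_mul_le_iff₀ (mul_pos h3 (h2.trans_le h1)), mul_one]
  exact mul_le_mul_of_nonneg_left h1 h3.le

variable [∀ i, CompleteSpace (H i)] [∀ k, CompleteSpace (G k)]

theorem sum_inner_couplingOp (x v : ∀ i, H i) :
    ∑ i, ⟪couplingOp φ L i x, v i⟫ =
      ∑ k, ⟪gradient (φ k) (∑ i, L k i (x i)), ∑ i, L k i (v i)⟫ := by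
  simp only [couplingOp, sum_inner, inner_sum, ContinuousLinearMap.adjoint_inner_left]
  exact Finset.sum_comm

/-- Cauchy-Schwarz over the `p` summands gives the factor `p`; `betaConst` is the constant that
absorbs `p * τ k * ∑ i, ‖L k i‖ ^ 2` for every `k`, after which Baillon-Haddad applies to each `φ
k`. -/
theorem betaConst_mul_sum_norm_couplingOp_sub_sq_le (hp : 1 ≤ p) (hτ : ∀ k, 0 < τ k)
    (hφconv : ∀ k, ConvexOn ℝ Set.univ (φ k)) (hφdiff : ∀ k, LipschitzDifferentiable (τ k) (φ k))
    (hL : ∀ k, 0 < ∑ i, ‖L k i‖ ^ 2) (x y : ∀ i, H i) :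
    betaConst τ L * ∑ i, ‖couplingOp φ L i x - couplingOp φ L i y‖ ^ 2 ≤
      ∑ i, ⟪couplingOp φ L i x - couplingOp φ L i y, x i - y i⟫ := by
  set d : ∀ k, G k := fun k =>
    gradient (φ k) (∑ i, L k i (x i)) - gradient (φ k) (∑ i, L k i (y i)) with hd
  have hsub : ∀ i, couplingOp φ L i x - couplingOp φ L i y =
      ∑ k, ContinuousLinearMap.adjoint (L k i) (d k) := fun i => by
    simp only [couplingOp, hd, map_sub, Finset.sum_sub_distrib]
  have h1 : ∀ i, ‖couplingOp φ L i x - couplingOp φ L i y‖ ^ 2 ≤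
      p * ∑ k, ‖L k i‖ ^ 2 * ‖d k‖ ^ 2 := by
    intro i
    rw [hsub]
    calc _ ≤ (∑ k, ‖L k i‖ * ‖d k‖) ^ 2 := by
          gcongr
          refine (norm_sum_le _ _).trans (Finset.sum_le_sum fun k _ => ?_)
          refine (ContinuousLinearMap.le_opNorm _ _).trans_eq ?_
          rw [LinearIsometryEquiv.norm_map]
      _ ≤ (Finset.univ : Finset (Fin p)).card * ∑ k, (‖L k i‖ * ‖d k‖) ^ 2 :=
          sq_sum_le_card_mul_sum_sq
      _ = _ := by simp [mul_pow]
  calc _ ≤ betaConst τ L * ∑ i, p * ∑ k, ‖L k i‖ ^ 2 * ‖d k‖ ^ 2 := by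
        have := (betaConst_pos hp hτ hL).le
        gcongr with i
        exact h1 i
    _ = ∑ k, betaConst τ L * (p * (τ k * ∑ i, ‖L k i‖ ^ 2)) * ((τ k)⁻¹ * ‖d k‖ ^ 2) := by
        rw [← Finset.mul_sum, Finset.sum_comm, Finset.mul_sum, Finset.mul_sum]
        refine Finset.sum_congr rfl fun k _ => ?_
        rw [← Finset.sum_mul]
        have := (hτ k).ne'
        field_simp
    _ ≤ ∑ k, 1 * ((τ k)⁻¹ * ‖d k‖ ^ 2) := by
        refine Finset.sum_le_sum fun k _ => ?_
        have := hτ k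
        exact mul_le_mul_of_nonneg_right (betaConst_mul_le hp hτ hL k) (by positivity)
    _ ≤ ∑ k, ⟪d k, ∑ i, L k i (x i - y i)⟫ := by
        refine Finset.sum_le_sum fun k _ => ?_
        have := (hφdiff k).norm_gradient_sub_sq_le (hφconv k) (hτ k)
          (∑ i, L k i (x i)) (∑ i, L k i (y i))
        rw [one_mul]
        simpa only [map_sub, Finset.sum_sub_distrib] using this
    _ = _ := by
        simp only [inner_sub_left (couplingOp φ L _ x), Finset.sum_sub_distrib,
          sum_inner_couplingOp (v := fun i => x i - y i), hd, inner_sub_left (gradient _ _)]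

end Coupling

/-! ### First order optimality conditions -/

section Optimality

theorem EReal.sum_eq_coe {ι : Type*} {s : Finset ι} {g : ι → EReal} {r : ι → ℝ}
    (h : ∀ i, g i = r i) : ∑ i ∈ s, g i = ((∑ i ∈ s, r i : ℝ) : EReal) := by
  classical
  induction s using Finset.induction_on with
  | empty => simp
  | insert i s hi ih => rw [Finset.sum_insert hi, Finset.sum_insert hi, ih, h, EReal.coe_add]

theorem EReal.sum_ne_bot {ι : Type*} {s : Finset ι} {g : ι → EReal} (h : ∀ i, g i ≠ ⊥) :
    ∑ i ∈ s, g i ≠ ⊥ := by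
  classical
  induction s using Finset.induction_on with
  | empty => simp
  | insert i s hi ih => rw [Finset.sum_insert hi]; exact EReal.add_ne_bot_iff.2 ⟨h i, ih⟩

theorem EReal.sum_eq_top {ι : Type*} [Fintype ι] {g : ι → EReal} (h : ∀ i, g i ≠ ⊥) {j : ι}
    (hj : g j = ⊤) : ∑ i, g i = ⊤ := by
  classical
  rw [← Finset.add_sum_erase _ _ (Finset.mem_univ j), hj,
    EReal.top_add_of_ne_bot (EReal.sum_ne_bot h)]

variable {m p : ℕ} {H : Fin m → Type*} {G : Fin p → Type*}
    [∀ i, NormedAddCommGroup (H i)] [∀ i, InnerProductSpace ℝ (H i)]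
    [∀ k, NormedAddCommGroup (G k)] [∀ k, InnerProductSpace ℝ (G k)]
    {f : ∀ i, H i → EReal} {φ : ∀ k, G k → ℝ} {τ : Fin p → ℝ} {L : ∀ k i, H i →L[ℝ] G k}

theorem objective_eq_coe {x : ∀ i, H i} {r : Fin m → ℝ} (h : ∀ i, f i (x i) = r i) :
    objective f φ L x = ((∑ i, r i + ∑ k, φ k (∑ i, L k i (x i)) : ℝ) : EReal) := by
  rw [objective, EReal.sum_eq_coe h, EReal.coe_add]

theorem objective_eq_top (hf : ∀ i, GammaZero (f i)) {x : ∀ i, H i} {j : Fin m}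
    (hj : f j (x j) = ⊤) : objective f φ L x = ⊤ := by
  rw [objective, EReal.sum_eq_top (fun i => (hf i).ne_bot (x i)) hj, EReal.top_add_coe]

variable [∀ i, CompleteSpace (H i)] [∀ k, CompleteSpace (G k)]

/-- The optimality conditions use `couplingOp` as the gradient of the smooth part only through this
inequality and its continuity. -/
theorem sum_add_sum_inner_couplingOp_le (hφconv : ∀ k, ConvexOn ℝ Set.univ (φ k))
    (hφdiff : ∀ k, Differentiable ℝ (φ k)) (x y : ∀ i, H i) :
    ∑ k, φ k (∑ i, L k i (x i)) + ∑ i, ⟪couplingOp φ L i x, y i - x i⟫ ≤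
      ∑ k, φ k (∑ i, L k i (y i)) := by
  rw [sum_inner_couplingOp (v := fun i => y i - x i), ← Finset.sum_add_distrib]
  refine Finset.sum_le_sum fun k _ => ?_
  have := (hφconv k).add_inner_gradient_le (hφdiff k) (∑ i, L k i (x i)) (∑ i, L k i (y i))
  simpa only [map_sub, Finset.sum_sub_distrib] using this

theorem continuous_couplingOp (hφdiff : ∀ k, LipschitzDifferentiable (τ k) (φ k)) (i : Fin m) :
    Continuous (couplingOp φ L i) := by
  have h : ∀ k, Continuous (gradient (φ k)) := fun k =>
    (LipschitzWith.of_dist_le' (K := τ k) fun x y => by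
      simpa only [dist_eq_norm] using (hφdiff k).2 x y).continuous
  unfold couplingOp
  refine continuous_finsetSum _ fun k _ => ?_
  exact (ContinuousLinearMap.continuous _).comp ((h k).comp (by fun_prop))

/-- First order optimality conditions for the minimization of `objective`. -/
theorem isMinOn_objective_iff (hf : ∀ i, GammaZero (f i))
    (hφconv : ∀ k, ConvexOn ℝ Set.univ (φ k))
    (hφdiff : ∀ k, LipschitzDifferentiable (τ k) (φ k)) {x : ∀ i, H i} :
    IsMinOn (objective f φ L) Set.univ x ↔
      ∀ i, IsSubgradientAt (f i) (x i) (-couplingOp φ L i x) := by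
  constructor
  · intro hx
    have hmin : ∀ y, objective f φ L x ≤ objective f φ L y := fun y => hx (Set.mem_univ y)
    have hfin : ∀ i, f i (x i) ≠ ⊤ := by
      intro i hi
      choose y hy using fun i => (hf i).proper
      choose s hs using fun i => (hf i).exists_coe (hy i).ne
      have := hmin y
      rw [objective_eq_top hf hi, objective_eq_coe hs] at this
      exact EReal.coe_ne_top _ (top_le_iff.1 this)
    choose r hr using fun i => (hf i).exists_coe (hfin i)
    have key : ∀ (y : ∀ i, H i) (s : Fin m → ℝ), (∀ i, f i (y i) = s i) →
        ∑ i, r i - ∑ i, s i ≤ ∑ i, ⟪couplingOp φ L i x, y i - x i⟫ := by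
      intro y s hs
      -- The gradient inequality is taken at the intermediate point, looking back to `x`; continuity
      -- of `couplingOp` then allows `t` to tend to 0.
      have h1 : ∀ t ∈ Set.Ioo (0 : ℝ) 1, ∑ i, r i - ∑ i, s i ≤
          ∑ i, ⟪couplingOp φ L i (fun j => (1 - t) • x j + t • y j), y i - x i⟫ := by
        rintro t ⟨ht0, ht1⟩
        choose u hu hle using fun i => (hf i).combo_le (hr i) (hs i) ht0 ht1
        set xt : ∀ j, H j := fun j => (1 - t) • x j + t • y j with hxt
        have h2 := hmin xt
        rw [objective_eq_coe hr, objective_eq_coe hu, EReal.coe_le_coe_iff] at h2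
        have h3 := sum_add_sum_inner_couplingOp_le (L := L) hφconv (fun k => (hφdiff k).1) xt x
        have h4 : ∑ i, ⟪couplingOp φ L i xt, x i - xt i⟫ =
            -(t * ∑ i, ⟪couplingOp φ L i xt, y i - x i⟫) := by
          rw [Finset.mul_sum, ← Finset.sum_neg_distrib]
          refine Finset.sum_congr rfl fun i _ => ?_
          have : x i - xt i = -(t • (y i - x i)) := by
            simp only [hxt]; module
          rw [this, inner_neg_right, inner_smul_right]
        have h5 : ∑ i, u i ≤ (1 - t) * ∑ i, r i + t * ∑ i, s i := by
          rw [Finset.mul_sum, Finset.mul_sum, ← Finset.sum_add_distrib]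
          exact Finset.sum_le_sum fun i _ => hle i
        have h6 : t * (∑ i, r i - ∑ i, s i) ≤
            t * ∑ i, ⟪couplingOp φ L i xt, y i - x i⟫ := by linarith
        exact le_of_mul_le_mul_left h6 ht0
      have hlim : Tendsto (fun t : ℝ => ∑ i, ⟪couplingOp φ L i
          (fun j => (1 - t) • x j + t • y j), y i - x i⟫) (𝓝[>] 0)
          (𝓝 (∑ i, ⟪couplingOp φ L i x, y i - x i⟫)) := by
        have hc : Continuous (fun t : ℝ => ∑ i, ⟪couplingOp φ L i
            (fun j => (1 - t) • x j + t • y j), y i - x i⟫) := by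
          refine continuous_finsetSum _ fun i _ => ?_
          exact ((continuous_couplingOp hφdiff i).comp (by fun_prop)).inner continuous_const
        simpa using (hc.tendsto 0).mono_left nhdsWithin_le_nhds
      exact ge_of_tendsto hlim (by
        filter_upwards [Ioo_mem_nhdsGT (zero_lt_one' ℝ)] with t ht using h1 t ht)
    intro i y
    by_cases hy : f i y = ⊤
    · rw [hy]; exact le_top
    obtain ⟨s, hs⟩ := (hf i).exists_coe hy
    -- Changing one coordinate at a time decouples the joint inequality.
    have h1 := key (Function.update x i y) (Function.update r i s) fun j => by
      rcases eq_or_ne j i with rfl | hj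
      · simpa using hs
      · simpa [hj] using hr j
    rw [← Finset.sum_sub_distrib, Finset.sum_eq_single i (fun j _ hj => by simp [hj]) (by simp),
      Finset.sum_eq_single i (fun j _ hj => by simp [hj]) (by simp)] at h1
    simp only [Function.update_self] at h1
    rw [hr, hs, ← EReal.coe_add, EReal.coe_le_coe_iff, inner_neg_right, real_inner_comm]
    linarith
  · intro h y _
    change objective f φ L x ≤ objective f φ L y
    choose r hr using fun i => (hf i).exists_coe ((hf i).ne_top_of_isSubgradientAt (h i))
    by_cases hy : ∃ i, f i (y i) = ⊤
    · obtain ⟨i, hi⟩ := hy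
      rw [objective_eq_top hf hi]; exact le_top
    push Not at hy
    choose s hs using fun i => (hf i).exists_coe (hy i)
    rw [objective_eq_coe hr, objective_eq_coe hs, EReal.coe_le_coe_iff]
    have h1 := sum_add_sum_inner_couplingOp_le (L := L) hφconv (fun k => (hφdiff k).1) x y
    have h2 : ∑ i, (r i - ⟪couplingOp φ L i x, y i - x i⟫) ≤ ∑ i, s i := by
      refine Finset.sum_le_sum fun i _ => ?_
      have := h i (y i)
      rw [hr, hs, ← EReal.coe_add, EReal.coe_le_coe_iff, inner_neg_right, real_inner_comm] at this
      linarith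
    rw [Finset.sum_sub_distrib] at h2
    linarith

end Optimality

/-! ### Reduction of all perturbations to summable errors -/

section Errors

theorem summable_norm_sub_of_tsum_iSup_lt_top {X Y : Type*} [NormedAddCommGroup X]
    [NormedAddCommGroup Y] {g h : ℕ → X → Y} {ρ : ℝ}
    (hs : ∑' n, ⨆ (y : X) (_ : ‖y‖ ≤ ρ), ‖g n y - h n y‖ₑ < ⊤) {u : ℕ → X}
    (hu : ∀ n, ‖u n‖ ≤ ρ) : Summable fun n => ‖g n (u n) - h n (u n)‖ := by
  have h1 : ∑' n, ‖g n (u n) - h n (u n)‖ₑ < ⊤ :=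
    (ENNReal.tsum_le_tsum fun n => le_iSup₂ (f := fun y (_ : ‖y‖ ≤ ρ) => ‖g n y - h n y‖ₑ)
      (u n) (hu n)).trans_lt hs
  simpa using ENNReal.summable_toReal h1.ne

variable {E : Type*} [NormedAddCommGroup E] [InnerProductSpace ℝ E]

/-- An inexact forward-backward iteration, in which the resolvents `J n` are approximated by
nonexpansive operators `J' n` and the relaxation is perturbed, is an exact iteration up to summable
errors. -/
theorem summable_norm_forward_backward_error {J J' : ℕ → E → E} {B : E → E} {β : ℝ}
    (hB : ∀ x y, β * ‖B x - B y‖ ^ 2 ≤ ⟪B x - B y, x - y⟫)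
    (hJ' : ∀ n u v, ‖J' n u - J' n v‖ ≤ ‖u - v‖)
    (hJJ' : ∀ (u : ℕ → E) (C : ℝ), (∀ n, ‖u n‖ ≤ C) → Summable fun n => ‖J' n (u n) - J n (u n)‖)
    {γ lam δ : ℕ → ℝ} (hγ0 : ∀ n, 0 ≤ γ n) (hγ : ∀ n, γ n ≤ 2 * β)
    (hlam : ∀ n, lam n ∈ Set.Icc 0 1) (hδ0 : ∀ n, 0 ≤ δ n) (hδ : Summable δ)
    {s : E} (hs : ∀ n, J n (s - γ n • B s) = s)
    {a b x w : ℕ → E} (ha : Summable fun n => ‖a n‖) (hb : Summable fun n => ‖b n‖)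
    (hw : ∀ n, w n = J' n (x n - γ n • (B (x n) + b n)) + a n)
    (hx : ∀ n, ‖x (n + 1) - (lam n • x n + (1 - lam n) • w n)‖ ≤ δ n * ‖x n - w n‖) :
    Summable fun n => ‖x (n + 1) -
      (lam n • x n + (1 - lam n) • J n (x n - γ n • B (x n)))‖ := by
  have hfwd : ∀ n y, ‖(x n - γ n • B (x n)) - (y - γ n • B y)‖ ≤ ‖x n - y‖ := fun n y =>
    norm_forward_sub_le (hγ0 n) (hγ n) hB (x n) y
  have hsb : ∀ n, ‖s - γ n • B s‖ ≤ ‖s‖ + 2 * β * ‖B s‖ := fun n => by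
    refine (norm_sub_le _ _).trans ?_
    rw [norm_smul, Real.norm_of_nonneg (hγ0 n)]
    gcongr
    exact hγ n
  have hbw : ∀ n, ‖J' n (x n - γ n • (B (x n) + b n)) - J' n (x n - γ n • B (x n))‖ ≤
      2 * β * ‖b n‖ := fun n => by
    refine (hJ' n _ _).trans ?_
    have : x n - γ n • (B (x n) + b n) - (x n - γ n • B (x n)) = -(γ n • b n) := by module
    rw [this, norm_neg, norm_smul, Real.norm_of_nonneg (hγ0 n)]
    gcongr
    exact hγ n
  -- Total error of one step measured against the fixed point `s`. It is summable without a bound on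
  -- `x`, because the points `s - γ n • B s` are bounded.
  set η : ℕ → ℝ := fun n => 2 * β * ‖b n‖ + ‖J' n (s - γ n • B s) - J n (s - γ n • B s)‖ + ‖a n‖
    with hη
  have hβ0 : 0 ≤ 2 * β := (hγ0 0).trans (hγ 0)
  have hη0 : ∀ n, 0 ≤ η n := fun n => by positivity
  have hηs : Summable η := ((hb.mul_left (2 * β)).add (hJJ' _ _ hsb)).add ha
  have hws : ∀ n, ‖w n - s‖ ≤ ‖x n - s‖ + η n := by
    intro n
    have e : w n - s = (J' n (x n - γ n • (B (x n) + b n)) - J' n (x n - γ n • B (x n))) +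
        (J' n (x n - γ n • B (x n)) - J' n (s - γ n • B s)) +
        (J' n (s - γ n • B s) - J n (s - γ n • B s)) + a n := by
      rw [hw, hs]; abel
    rw [e]
    refine norm_add₄_le.trans ?_
    have h1 := hbw n
    have h2 := (hJ' n _ _).trans (hfwd n s)
    simp only [hη]
    linarith
  have hxw : ∀ n, ‖x n - w n‖ ≤ 2 * ‖x n - s‖ + η n := fun n => by
    have h1 := norm_sub_le_norm_sub_add_norm_sub (x n) s (w n)
    rw [norm_sub_rev s] at h1
    linarith [hws n]
  -- `hJJ'` applies only along bounded sequences, so this must precede its use at the iterates. The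
  -- relaxation error grows with `‖x n - s‖`, hence the multiplicative factor `1 + 2 * δ n`.
  obtain ⟨C, hC⟩ : ∃ C, ∀ n, ‖x n - s‖ ≤ C := by
    have hδη : Summable fun n => δ n * η n := by
      obtain ⟨K, hK⟩ := hηs.tendsto_atTop_zero.bddAbove_range
      refine Summable.of_nonneg_of_le (fun n => mul_nonneg (hδ0 n) (hη0 n)) (fun n => ?_)
        (hδ.mul_right K)
      exact mul_le_mul_of_nonneg_left (hK ⟨n, rfl⟩) (hδ0 n)
    refine exists_bound_of_le_mul_add_summable (α := fun n => 2 * δ n)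
      (e := fun n => η n + δ n * η n) (fun n => norm_nonneg _)
      (fun n => mul_nonneg zero_le_two (hδ0 n))
      (fun n => add_nonneg (hη0 n) (mul_nonneg (hδ0 n) (hη0 n))) (hδ.mul_left 2) (hηs.add hδη)
      fun n => ?_
    have e : x (n + 1) - s = (x (n + 1) - (lam n • x n + (1 - lam n) • w n)) +
        lam n • (x n - s) + (1 - lam n) • (w n - s) := by module
    have hl0 := (hlam n).1
    have hl1 : 0 ≤ 1 - lam n := sub_nonneg.2 (hlam n).2
    rw [e]
    refine norm_add₃_le.trans ?_
    rw [norm_smul, norm_smul, Real.norm_of_nonneg hl0, Real.norm_of_nonneg hl1]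
    have h1 := (hx n).trans (mul_le_mul_of_nonneg_left (hxw n) (hδ0 n))
    have h2 := mul_le_mul_of_nonneg_left (hws n) hl1
    have h3 := mul_nonneg hl0 (hη0 n)
    linarith
  have hub : ∀ n, ‖x n - γ n • B (x n)‖ ≤ C + (‖s‖ + 2 * β * ‖B s‖) := fun n => by
    have h1 := norm_le_norm_sub_add (x n - γ n • B (x n)) (s - γ n • B s)
    linarith [hfwd n s, hC n, hsb n]
  obtain ⟨K, hK⟩ : ∃ K, ∀ n, ‖x n - w n‖ ≤ K := by
    obtain ⟨K, hK⟩ := hηs.tendsto_atTop_zero.bddAbove_range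
    refine ⟨2 * C + K, fun n => ?_⟩
    have h1 : η n ≤ K := hK ⟨n, rfl⟩
    linarith [hxw n, hC n]
  refine Summable.of_nonneg_of_le (fun n => norm_nonneg _) (fun n => ?_)
    ((hδ.mul_right K).add (((hb.mul_left (2 * β)).add (hJJ' _ _ hub)).add ha))
  have e : x (n + 1) - (lam n • x n + (1 - lam n) • J n (x n - γ n • B (x n))) =
      (x (n + 1) - (lam n • x n + (1 - lam n) • w n)) +
      (1 - lam n) • ((J' n (x n - γ n • (B (x n) + b n)) - J' n (x n - γ n • B (x n))) +
        (J' n (x n - γ n • B (x n)) - J n (x n - γ n • B (x n))) + a n) := by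
    rw [hw]; module
  rw [e]
  refine (norm_add_le _ _).trans (add_le_add
    ((hx n).trans (mul_le_mul_of_nonneg_left (hK n) (hδ0 n))) ?_)
  have hl1 : 0 ≤ 1 - lam n := sub_nonneg.2 (hlam n).2
  rw [norm_smul, Real.norm_of_nonneg hl1]
  refine (mul_le_of_le_one_left (norm_nonneg _) (by linarith [(hlam n).1])).trans ?_
  refine norm_add₃_le.trans ?_
  gcongr
  exact hbw n

end Errors

/-! ### Weak topology and norms on the Hilbert product -/

theorem tendsto_toWeakSpace_of_inner {X : Type*} [NormedAddCommGroup X] [InnerProductSpace ℝ X]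
    [CompleteSpace X] {x : ℕ → X} {z : X}
    (h : ∀ y, Tendsto (fun n => ⟪x n, y⟫) atTop (𝓝 ⟪z, y⟫)) :
    Tendsto (fun n => toWeakSpace ℝ X (x n)) atTop (𝓝 (toWeakSpace ℝ X z)) := by
  -- The evaluation criterion needs a pairing that separates points; Riesz functionals do so.
  have hinj : Function.Injective (topDualPairing ℝ X).flip := by
    intro u v huv
    refine ext_inner_left ℝ fun w => ?_
    simpa using LinearMap.congr_fun huv (InnerProductSpace.toDual ℝ X w)
  refine (WeakBilin.tendsto_iff_forall_eval_tendsto (topDualPairing ℝ X).flip hinj).2 fun ψ => ?_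
  have h1 := h ((InnerProductSpace.toDual ℝ X).symm ψ)
  simp only [real_inner_comm ((InnerProductSpace.toDual ℝ X).symm ψ) _,
    InnerProductSpace.toDual_symm_apply] at h1
  exact h1

theorem PiLp.norm_le_sum_norm {ι : Type*} [Fintype ι] {X : ι → Type*}
    [∀ i, SeminormedAddCommGroup (X i)] (v : PiLp 2 X) : ‖v‖ ≤ ∑ i, ‖v i‖ := by
  refine (abs_le_of_sq_le_sq' ?_ (Finset.sum_nonneg fun i _ => norm_nonneg _)).2
  rw [PiLp.norm_sq_eq_of_L2]
  exact Finset.sum_sq_le_sq_sum_of_nonneg fun i _ => norm_nonneg _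

theorem PiLp.norm_le_norm_of_forall_le {ι : Type*} [Fintype ι] {X : ι → Type*}
    [∀ i, SeminormedAddCommGroup (X i)] {u v : PiLp 2 X} (h : ∀ i, ‖u i‖ ≤ ‖v i‖) :
    ‖u‖ ≤ ‖v‖ := by
  refine (abs_le_of_sq_le_sq' ?_ (norm_nonneg _)).2
  rw [PiLp.norm_sq_eq_of_L2, PiLp.norm_sq_eq_of_L2]
  gcongr with i
  exact h i

theorem PiLp.summable_norm {ι : Type*} [Fintype ι] {X : ι → Type*}
    [∀ i, SeminormedAddCommGroup (X i)] {v : ℕ → PiLp 2 X} (h : ∀ i, Summable fun n => ‖v n i‖) :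
    Summable fun n => ‖v n‖ :=
  Summable.of_nonneg_of_le (fun _ => norm_nonneg _) (fun n => PiLp.norm_le_sum_norm (v n))
    (summable_sum fun i _ => h i)

/-! ### The algorithm as one iteration in the product space -/

theorem theoremt
    -- the minimization problem
    {m p : ℕ} (hp : 1 ≤ p)
    {H : Fin m → Type*} {G : Fin p → Type*}
    [∀ i, NormedAddCommGroup (H i)] [∀ i, InnerProductSpace ℝ (H i)] [∀ i, CompleteSpace (H i)]
    [∀ k, NormedAddCommGroup (G k)] [∀ k, InnerProductSpace ℝ (G k)] [∀ k, CompleteSpace (G k)]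
    (f : ∀ i, H i → EReal) (hf : ∀ i, GammaZero (f i))
    (τ : Fin p → ℝ) (hτ : ∀ k, 0 < τ k)
    (φ : ∀ k, G k → ℝ) (hφconv : ∀ k, ConvexOn ℝ Set.univ (φ k))
    (hφdiff : ∀ k, LipschitzDifferentiable (τ k) (φ k))
    (L : ∀ k i, H i →L[ℝ] G k) (hL : ∀ k, 0 < ∑ i, ‖L k i‖ ^ 2)
    (hsol : ∃ x : ∀ i, H i, IsMinOn (objective f φ L) Set.univ x)
    -- the parameters of the algorithm
    (ε : ℝ) (hε : ε ∈ Set.Ioo 0 (min 1 (betaConst τ L)))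
    (γ : ℕ → ℝ) (hγ : ∀ n, γ n ∈ Set.Icc ε (2 * betaConst τ L - ε))
    (lam : ℕ → ℝ) (hlam : ∀ n, lam n ∈ Set.Icc 0 (1 - ε))
    -- the approximations of the functions
    (fn : ∀ i, ℕ → H i → EReal) (hfn : ∀ i n, GammaZero (fn i n))
    (hfn_sum : ∀ i, ∀ ρ : ℝ, 0 < ρ →
      ∑' n, ⨆ (y : H i) (_ : ‖y‖ ≤ ρ),
        ‖prox (fun z => (γ n : EReal) * fn i n z) y
          - prox (fun z => (γ n : EReal) * f i z) y‖ₑ < ⊤)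
    -- the error sequences and the individual relaxation parameters
    (a b : ∀ i, ℕ → H i)
    (ha : ∀ i, Summable fun n => ‖a i n‖) (hb : ∀ i, Summable fun n => ‖b i n‖)
    (lami : Fin m → ℕ → ℝ) (hlami : ∀ i n, lami i n ∈ Set.Ico 0 1)
    (hlami_sum : ∀ i, Summable fun n => |lami i n - lam n|)
    -- the sequences generated by the algorithm, from an arbitrary starting point
    (x : ∀ i, ℕ → H i)
    (hx : ∀ i n, x i (n + 1) = lami i n • x i n + (1 - lami i n) •
      (prox (fun z => (γ n : EReal) * fn i n z)
          (x i n - γ n • (couplingOp φ L i (fun j => x j n) + b i n)) + a i n)) :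
    ∃ xs : ∀ i, H i,
      (∀ i, Tendsto (fun n => toWeakSpace ℝ (H i) (x i n)) atTop
        (𝓝 (toWeakSpace ℝ (H i) (xs i)))) ∧
      IsMinOn (objective f φ L) Set.univ xs := by
  have hβ := betaConst_pos hp hτ hL
  have hγ0 : ∀ n, 0 < γ n := fun n => hε.1.trans_le (hγ n).1
  set B : PiLp 2 H → PiLp 2 H := fun z => WithLp.toLp 2 fun i => couplingOp φ L i (fun j => z j)
   
  set J : ℝ → PiLp 2 H → PiLp 2 H := fun c u =>
    WithLp.toLp 2 fun i => prox (fun z => (c : EReal) * f i z) (u i)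
  set J' : ℕ → PiLp 2 H → PiLp 2 H := fun n u =>
    WithLp.toLp 2 fun i => prox (fun z => (γ n : EReal) * fn i n z) (u i)
  set X : ℕ → PiLp 2 H := fun n => WithLp.toLp 2 fun i => x i n
  set a' : ℕ → PiLp 2 H := fun n => WithLp.toLp 2 fun i => a i n
  set b' : ℕ → PiLp 2 H := fun n => WithLp.toLp 2 fun i => b i n
  let A : PiLp 2 H → PiLp 2 H → Prop := fun z g => ∀ i, IsSubgradientAt (f i) (z i) (g i)
  have hB : ∀ u v, betaConst τ L * ‖B u - B v‖ ^ 2 ≤ ⟪B u - B v, u - v⟫ := fun u v => by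
    rw [PiLp.norm_sq_eq_of_L2, PiLp.inner_apply]
    exact betaConst_mul_sum_norm_couplingOp_sub_sq_le hp hτ hφconv hφdiff hL _ _
  have hA : ∀ z u y v, A z u → A y v → 0 ≤ ⟪z - y, u - v⟫ := fun z u y v hz hy => by
    rw [PiLp.inner_apply]
    exact Finset.sum_nonneg fun i _ => (hf i).inner_nonneg_of_isSubgradientAt (hz i) (hy i)
  have hJ : ∀ c, 0 < c → ∀ u, A (J c u) (c⁻¹ • (u - J c u)) := fun c hc u i =>
    (hf i).isSubgradientAt_prox_const_mul hc (u i)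
  have hAB : ∀ z, A z (-B z) ↔ IsMinOn (objective f φ L) Set.univ fun i => z i := fun z =>
    (isMinOn_objective_iff hf hφconv hφdiff).symm
  obtain ⟨xb, hxb⟩ := hsol
  set s : PiLp 2 H := WithLp.toLp 2 xb
  have hs : A s (-B s) := (hAB s).2 hxb
  -- Monotonicity between the resolvent point `q` and the zero `s` reduces to `0 ≤ -‖q - s‖ ^ 2`.
  have hfix : ∀ n, J (γ n) (s - γ n • B s) = s := fun n => by
    have h1 := hA _ _ _ _ (hJ (γ n) (hγ0 n) (s - γ n • B s)) hs
    set q := J (γ n) (s - γ n • B s)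
    have h2 := mul_nonneg (hγ0 n).le h1
    have e : γ n • (γ n)⁻¹ • (s - γ n • B s - q) - γ n • -B s = -(q - s) := by
      rw [smul_inv_smul₀ (hγ0 n).ne']; module
    rw [← inner_smul_right, smul_sub, e, inner_neg_right, real_inner_self_eq_norm_sq] at h2
    have h3 : ‖q - s‖ = 0 := (pow_eq_zero_iff two_ne_zero).1 (by
      have := sq_nonneg ‖q - s‖
      linarith)
    exact sub_eq_zero.1 (norm_eq_zero.1 h3)
  have hJ'ne : ∀ n u v, ‖J' n u - J' n v‖ ≤ ‖u - v‖ := fun n u v =>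
    PiLp.norm_le_norm_of_forall_le fun i =>
      ((hfn i n).const_mul (hγ0 n)).norm_prox_sub_le (u i) (v i)
  have hJJ' : ∀ (u : ℕ → PiLp 2 H) (C : ℝ), (∀ n, ‖u n‖ ≤ C) →
      Summable fun n => ‖J' n (u n) - J (γ n) (u n)‖ := fun u C hu => by
    refine PiLp.summable_norm fun i => ?_
    change Summable fun n => ‖prox (fun z => (γ n : EReal) * fn i n z) (u n i) -
      prox (fun z => (γ n : EReal) * f i z) (u n i)‖
    refine summable_norm_sub_of_tsum_iSup_lt_top
      (g := fun n => prox (fun z => (γ n : EReal) * fn i n z))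
      (h := fun n => prox (fun z => (γ n : EReal) * f i z)) (u := fun n => u n i)
      (hfn_sum i (max C 1) (by positivity)) fun n => ?_
    exact (PiLp.norm_apply_le (u n) i).trans ((hu n).trans (le_max_left _ _))
  set w : ℕ → PiLp 2 H := fun n => J' n (X n - γ n • (B (X n) + b' n)) + a' n
  -- Replacing `lami i n` by the common `lam n` changes coordinate `i` by `(lami i n - lam n) • (X n
  -- - w n) i`.
  have hXstep : ∀ n, ‖X (n + 1) - (lam n • X n + (1 - lam n) • w n)‖ ≤
      (∑ i, |lami i n - lam n|) * ‖X n - w n‖ := fun n => by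
    refine (PiLp.norm_le_sum_norm _).trans ?_
    rw [Finset.sum_mul]
    refine Finset.sum_le_sum fun i _ => ?_
    have e : (X (n + 1) - (lam n • X n + (1 - lam n) • w n)) i =
        (lami i n - lam n) • (X n - w n) i := by
      have h1 : X (n + 1) i = lami i n • X n i + (1 - lami i n) • w n i := hx i n
      simp only [PiLp.sub_apply, PiLp.add_apply, PiLp.smul_apply, h1]
      module
    rw [e, norm_smul, Real.norm_eq_abs]
    gcongr
    exact PiLp.norm_apply_le _ i
  have ha' : Summable fun n => ‖a' n‖ := PiLp.summable_norm ha
  have hb' : Summable fun n => ‖b' n‖ := PiLp.summable_norm hb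
  have herr := summable_norm_forward_backward_error (J := fun n => J (γ n)) (J' := J') (B := B)
    (δ := fun n => ∑ i, |lami i n - lam n|) (w := w) (x := X) (a := a') (b := b') (s := s)
    hB hJ'ne hJJ' (fun n => (hγ0 n).le)
    (fun n => (hγ n).2.trans (by linarith [hε.1]))
    (fun n => ⟨(hlam n).1, (hlam n).2.trans (by linarith [hε.1])⟩)
    (fun n => Finset.sum_nonneg fun i _ => abs_nonneg _) (summable_sum fun i _ => hlami_sum i)
    hfix ha' hb' (fun n => rfl) hXstep
  -- The error is defined as the deviation from the exact step, so the recursion holds by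
  -- construction and `herr` is its summability.
  obtain ⟨z, hz, hlim⟩ := forward_backward_tendsto (x := X) hε.1 hA hJ hβ hB hγ hlam ⟨s, hs⟩ herr
    fun n => (add_sub_cancel _ _).symm
  have hmin := (hAB z).1 hz
  refine ⟨fun i => z i, fun i => tendsto_toWeakSpace_of_inner (x := x i) fun y => ?_, hmin⟩
  have hsingle : ∀ v : PiLp 2 H, ⟪v, WithLp.toLp 2 (Pi.single i y)⟫ = ⟪v i, y⟫ := fun v => by
    rw [PiLp.inner_apply, Finset.sum_eq_single i (fun j _ hj => by simp [hj]) (by simp)]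
    simp
  have h1 := hlim (WithLp.toLp 2 (Pi.single i y))
  simp only [hsingle] at h1
  exact h1
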